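/- All graphs are finite, undirected, simple and node-labelled: a graph of dimension $d$ is $G=(V,E,\lambda)$ with $E$ symmetric and irreflexive and $\lambda:V\to\{0,1\}^d$. A node classifier of dimension $d$ is a property of pairs $(G,v)$, where $G$ is such a graph and $v$ is a node of $G$. A formula or a GNN expresses a node classifier $\mathcal C$ if it gives the same answer as $\mathcal C$ on all such pairs. * FO is first-order logic with equality, a binary predicate for $E$ and unary predicates $P_1,\dots,P_d$ with $P_i=\{v:\lambda(v)_i=1\}$. $\mathrm C^2$ consists of the formulas with at most two variables $x,y$ built from these atoms with Boolean connectives and counting quantifiers $\exists_k$ ("for at least $k$ nodes"), $k\in\mathbb N$. Node classifiers are defined by formulas $\varphi(x)$ with exactly one free variable. * An ACR-GNN classifier of dimension $d$ consists of finitely many layers $(\mathsf{agg},\mathsf{comb},\mathsf{read})$ of matching dimensions and a function $\mathsf{cls}$ from real vectors to truth values. Here $\mathsf{agg}$ and $\mathsf{read}$ are arbitrary functions from finite multisets of real vectors to real vectors, and $\mathsf{comb}$ is an arbitrary function from vectors to vectors. Starting from $\lambda$, each layer replaces the current labelling $\lambda$ by $$\lambda'(v)=\mathsf{comb}\Big(\lambda(v),\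 \mathsf{agg}(\{\!\{\lambda(w)\}\!\}_{w\in N_G(v)}),\ \mathsf{read}(\{\!\{\lambda(w)\}\!\}_{w\in V})\Big),$$ and the output at $v$ is $\mathsf{cls}$ of the final label of $v$. * The gadgetisation $\mathsf{gad}(G')$ of a finite directed loopless graph $G'=(V',E')$ is the undirected graph of dimension $3$ with a node $v^1_u$ labelled $(1,0,0)$ for each $u\in V'$ and, for each directed edge $(u,w)\in E'$, two nodes $v^2_{(u,w)}$ labelled $(0,1,0)$ and $v^3_{(u,w)}$ labelled $(0,0,1)$ and the three undirected edges $\{v^1_u,v^2_{(u,w)}\}$, $\{v^2_{(u,w)},v^3_{(u,w)}\}$, $\{v^3_{(u,w)},v^1_w\}$. * $\varphi_{\mathit{GadLin}}$ is the node classifier of dimension $3$ that accepts a node of $G$ if and only if $G$ is isomorphic to $\mathsf{gad}(G')$ for some $G'$ whose edge relation is a strict linear order on its finite set of nodes. **Corollary.** Over undirected graphs, there are FO node classifiers that are expressible by ACR-GNNs but not expressible in $\mathrm C^2$. In particular, $\varphi_{\mathit{GadLin}}$ is such a classifier: it is expressible in FO and by an ACR-GNN, but not in $\mathrm C^2$.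 Consequently, the open problem of Barceló et al. has a negative answer: it is not the case that the node classifiers expressible both in FO and by ACR-GNNs are exactly those expressible in $\mathrm C^2$. -/

import Mathlib

/-! ### Graphs -/

/-- A directed, loopless, node-labelled graph of dimension `d` on the node set `V`. -/
structure LabelledDigraph (d : ℕ) (V : Type) where
  edge : V → V → Prop
  irrefl : ∀ v, ¬ edge v v
  label : V → Fin d → Bool

/-- An undirected (simple) node-labelled graph of dimension `d` on the node set `V`. -/
structure LabelledGraph (d : ℕ) (V : Type) extends SimpleGraph V where
  label : V → Fin d → Bool

/-- Isomorphism of node-labelled undirected graphs. -/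
def LabelledGraph.IsIso {d : ℕ} {V W : Type} (G : LabelledGraph d V)
    (H : LabelledGraph d W) : Prop :=
  ∃ f : G.toSimpleGraph ≃g H.toSimpleGraph, ∀ v, H.label (f v) = G.label v

/-- A node classifier over finite undirected graphs of dimension `d`: a property of pairs
(graph, node). -/
def NodeClassifier (d : ℕ) : Type 1 :=
  ∀ (V : Type) [Fintype V], LabelledGraph d V → V → Prop

/-- Two node classifiers agree on all nodes of all finite undirected graphs. -/
def NodeClassifier.Agree {d : ℕ} (A B : NodeClassifier d) : Prop :=
  ∀ (V : Type) [Fintype V] (G : LabelledGraph d V) (v : V), A V G v ↔ B V G v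

/-! ### Aggregate-combine-readout graph neural networks -/

/-- A layer turning labellings by vectors of dimension `m` into labellings by vectors of
dimension `n`. -/
structure ACRLayer (m n : ℕ) where
  aggDim : ℕ
  readDim : ℕ
  agg : Multiset (Fin m → ℝ) → (Fin aggDim → ℝ)
  read : Multiset (Fin m → ℝ) → (Fin readDim → ℝ)
  comb : (Fin m → ℝ) → (Fin aggDim → ℝ) → (Fin readDim → ℝ) → (Fin n → ℝ)

open Classical in
/-- The new labelling computed by a layer on a finite undirected graph. -/
noncomputable def ACRLayer.apply {m n : ℕ} (A : ACRLayer m n) {V : Type} [Fintype V]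
    (G : SimpleGraph V) (x : V → Fin m → ℝ) : V → Fin n → ℝ :=
  fun v => A.comb (x v)
    (A.agg ((Finset.univ.filter fun w => G.Adj v w).val.map x))
    (A.read ((Finset.univ : Finset V).val.map x))

/-- A finite sequence of layers of matching dimensions. -/
inductive ACRLayers : ℕ → ℕ → Type
  | nil (n : ℕ) : ACRLayers n n
  | cons {m k n : ℕ} (A : ACRLayer m k) (rest : ACRLayers k n) : ACRLayers m n

/-- Successive application of the layers, the head of the sequence first. -/
noncomputable def ACRLayers.apply {V : Type} [Fintype V] (G : SimpleGraph V) :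
    {m n : ℕ} → ACRLayers m n → (V → Fin m → ℝ) → (V → Fin n → ℝ)
  | _, _, .nil _, x => x
  | _, _, .cons A rest, x => rest.apply G (A.apply G x)

/-- An ACR-GNN classifier of dimension `d`. -/
structure ACRGNN (d : ℕ) where
  outDim : ℕ
  layers : ACRLayers d outDim
  cls : (Fin outDim → ℝ) → Bool

/-- The node classifier computed by an ACR-GNN; the initial labelling consists of the binary
label vectors of the graph. -/
def ACRGNN.classifier {d : ℕ} (N : ACRGNN d) : NodeClassifier d :=
  fun _ _ G v =>
    N.cls (N.layers.apply G.toSimpleGraph (fun w i => if G.label w i then 1 else 0) v) = true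

/-! ### First-order logic -/

/-- Relation symbols: one binary symbol for edges and unary symbols for the labels. -/
inductive GraphRel (d : ℕ) : ℕ → Type
  | edge : GraphRel d 2
  | label (i : Fin d) : GraphRel d 1

/-- The first-order language of node-labelled graphs of dimension `d`. -/
def graphLanguage (d : ℕ) : FirstOrder.Language :=
  ⟨fun _ => Empty, GraphRel d⟩

/-- The first-order structure of a graph. -/
@[reducible] def LabelledGraph.toStructure {d : ℕ} {V : Type} (G : LabelledGraph d V) :
    (graphLanguage d).Structure V where
  funMap := fun f _ => Empty.elim f
  RelMap := fun R a =>
    match R, a with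
    | GraphRel.edge, a => G.Adj (a 0) (a 1)
    | GraphRel.label i, a => G.label (a 0) i = true

/-- First-order formulas (with equality) with exactly one free variable. -/
def FOFormula (d : ℕ) : Type :=
  {φ : (graphLanguage d).Formula (Fin 1) // φ.freeVarFinset = {0}}

/-- The node classifier defined by a first-order formula. -/
def FOFormula.classifier {d : ℕ} (φ : FOFormula d) : NodeClassifier d :=
  fun V _ G v =>
    letI : (graphLanguage d).Structure V := G.toStructure
    φ.1.Realize (fun _ => v)

/-! ### Two-variable logic with counting -/

/-- Formulas over the two variables `0` and `1`; `existsAtLeast k i φ` says that `φ` holds for at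
least `k` values of the variable `i`. -/
inductive C2Formula (d : ℕ) : Type
  | equal (i j : Fin 2) : C2Formula d
  | edge (i j : Fin 2) : C2Formula d
  | label (p : Fin d) (i : Fin 2) : C2Formula d
  | neg (φ : C2Formula d) : C2Formula d
  | and (φ ψ : C2Formula d) : C2Formula d
  | existsAtLeast (k : ℕ) (i : Fin 2) (φ : C2Formula d) : C2Formula d

/-- The free variables of a formula. -/
def C2Formula.freeVars {d : ℕ} : C2Formula d → Finset (Fin 2)
  | .equal i j => {i, j}
  | .edge i j => {i, j}
  | .label _ i => {i}
  | .neg φ => φ.freeVars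
  | .and φ ψ => φ.freeVars ∪ ψ.freeVars
  | .existsAtLeast _ i φ => φ.freeVars.erase i

/-- Satisfaction of a formula in a graph under an assignment of the two variables. -/
def C2Formula.Sat {d : ℕ} {V : Type} (G : LabelledGraph d V) : C2Formula d → (Fin 2 → V) → Prop
  | .equal i j, s => s i = s j
  | .edge i j, s => G.Adj (s i) (s j)
  | .label p i, s => G.label (s i) p = true
  | .neg φ, s => ¬ φ.Sat G s
  | .and φ ψ, s => φ.Sat G s ∧ ψ.Sat G s
  | .existsAtLeast k i φ, s =>
      ∃ S : Finset V, S.card = k ∧ ∀ w ∈ S, φ.Sat G (Function.update s i w)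

/-- The node classifier defined by a formula; it is used for formulas whose only free variable is
`0`, so that the value assigned to the variable `1` is irrelevant. -/
def C2Formula.classifier {d : ℕ} (φ : C2Formula d) : NodeClassifier d :=
  fun _ _ G v => φ.Sat G (fun _ => v)

/-! ### Expressibility over undirected graphs -/

def FOExpressible {d : ℕ} (A : NodeClassifier d) : Prop :=
  ∃ φ : FOFormula d, φ.classifier.Agree A

def ACRExpressible {d : ℕ} (A : NodeClassifier d) : Prop :=
  ∃ N : ACRGNN d, N.classifier.Agree A

def C2Expressible {d : ℕ} (A : NodeClassifier d) : Prop :=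
  ∃ φ : C2Formula d, φ.freeVars = {0} ∧ φ.classifier.Agree A

/-! ### Gadgetised linear orders -/

/-- Nodes of the gadgetisation: `one u` for every node `u`, and `two u w`, `three u w` for every
edge `(u, w)`. -/
inductive GadNode {d : ℕ} {V : Type} (D : LabelledDigraph d V) : Type
  | one (u : V) : GadNode D
  | two (u w : V) (h : D.edge u w) : GadNode D
  | three (u w : V) (h : D.edge u w) : GadNode D

/-- The three edges that replace an edge `(u, w)`, each listed in one direction. -/
inductive GadEdge {d : ℕ} {V : Type} (D : LabelledDigraph d V) : GadNode D → GadNode D → Prop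
  | first (u w : V) (h : D.edge u w) : GadEdge D (.one u) (.two u w h)
  | second (u w : V) (h : D.edge u w) : GadEdge D (.two u w h) (.three u w h)
  | third (u w : V) (h : D.edge u w) : GadEdge D (.three u w h) (.one w)

/-- The gadgetisation of a directed graph. -/
def gad {d : ℕ} {V : Type} (D : LabelledDigraph d V) : LabelledGraph 3 (GadNode D) where
  Adj x y := GadEdge D x y ∨ GadEdge D y x
  symm := ⟨fun _ _ h => h.symm⟩
  loopless := ⟨fun x h => by rcases h with h | h <;> cases h⟩
  label
    | .one _ => ![true, false, false]
    | .two _ _ _ => ![false, true, false]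
    | .three _ _ _ => ![false, false, true]

/-- The node classifier that accepts the nodes of a graph exactly if the graph is isomorphic to
the gadgetisation of some finite strict linear order. -/
def gadLin : NodeClassifier 3 :=
  fun _ _ G _ => ∃ (d : ℕ) (W : Type) (_ : Finite W) (D : LabelledDigraph d W),
    IsStrictTotalOrder W D.edge ∧ G.IsIso (gad D)

/-! All three statements about `gadLin` pass through `LabelledGraph.IsGadLin`, ten axioms on labels
and gadget paths. By `gadLin_iff` they hold exactly in the gadgetised strict linear orders. They are
visibly first-order, which gives FO expressibility.

For ACR-GNNs, the point is that a finite strict linear order is recognised by its out-degrees. They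
are pairwise distinct, and the successors of a node of out-degree `n` have out-degrees exactly `0,
..., n - 1`. Conversely, suppose that out-degrees are injective and every node has this successor
property. Then there is an edge from `u` to `w` exactly when the out-degree of `w` is smaller, so
the edges form a linear order. Gadgets let an undirected GNN see directions, so out-degrees and the
out-degrees of successors are computable in a few rounds of message passing
(`acrFeature_degreeCondition`). A readout checks injectivity. Arbitrary aggregation functions lose
no information on countable data, by `ACRFeature.step`.

For the lower bound in two-variable counting logic, take a long order and redirect the gadget of one
edge `(a, b)` between two central positions so that it ends in `a`. The result has a gadget loop and
is rejected. A formula of depth `q` with counts at most `k` cannot see the change. With `r`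
quantifiers left, it distinguishes only positions near the ends of the order, within a margin
proportional to `r`; in the centre all relevant neighbour and non-neighbour counts exceed `k`.
`CappedColouring` abstracts this invariant, `CappedColouring.sat_iff` is the game argument, and
`cappedColouring_redirect` verifies the invariant. -/

/-! ### Features computable by ACR-GNN layers -/

/-- A node feature of labelled graphs with values in `α`. -/
abbrev NodeFeature (d : ℕ) (α : Type) : Type 1 :=
  ∀ (V : Type) [Fintype V], LabelledGraph d V → V → α

/-- The layers of an ACR-GNN determine the feature. -/
def ACRFeature {d : ℕ} {α : Type} (f : NodeFeature d α) : Prop :=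
  ∃ (n : ℕ) (Ls : ACRLayers d n) (g : (Fin n → ℝ) → α),
    ∀ (V : Type) [Fintype V] (G : LabelledGraph d V) (v : V),
      f V G v = g (Ls.apply G.toSimpleGraph (fun w i => if G.label w i then 1 else 0) v)

open Classical in
/-- The values of a feature at the neighbours of a node. -/
noncomputable def NodeFeature.nbrs {d : ℕ} {α : Type} (f : NodeFeature d α) :
    NodeFeature d (Multiset α) :=
  fun V _ G v => (Finset.univ.filter fun w => G.Adj v w).val.map (f V G)

/-- The values of a feature at all nodes. -/
def NodeFeature.all {d : ℕ} {α : Type} (f : NodeFeature d α) : NodeFeature d (Multiset α) :=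
  fun V _ G _ => (Finset.univ : Finset V).val.map (f V G)

/-- A sequence of layers followed by one more layer. -/
def ACRLayers.snoc : {m k n : ℕ} → ACRLayers m k → ACRLayer k n → ACRLayers m n
  | _, _, _, .nil _, B => .cons B (.nil _)
  | _, _, _, .cons A rest, B => .cons A (rest.snoc B)

theorem ACRLayers.apply_snoc {V : Type} [Fintype V] (G : SimpleGraph V) {m k n : ℕ}
    (Ls : ACRLayers m k) (B : ACRLayer k n) (x : V → Fin m → ℝ) :
    (Ls.snoc B).apply G x = B.apply G (Ls.apply G x) := by
  induction Ls with
  | nil => rfl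
  | cons A rest ih => exact ih B _

theorem exists_real_coding (β : Type) [Countable β] [Nonempty β] :
    ∃ (enc : β → (Fin 1 → ℝ)) (dec : (Fin 1 → ℝ) → β), ∀ b, dec (enc b) = b := by
  obtain ⟨e, he⟩ := exists_injective_nat β
  have hinj : Function.Injective (fun (b : β) (_ : Fin 1) => (e b : ℝ)) := fun a b h =>
    he (Nat.cast_injective (R := ℝ) (congrFun h 0))
  exact ⟨_, Function.invFun _, Function.leftInverse_invFun hinj⟩

theorem ACRFeature.label (d : ℕ) :
    ACRFeature (fun _ _ G v => G.label v : NodeFeature d (Fin d → Bool)) := by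
  classical
  refine ⟨d, .nil d, fun x i => decide (x i = 1), fun V _ G v => ?_⟩
  funext i
  cases h : G.label v i <;> simp [ACRLayers.apply, h]

theorem ACRFeature.map {d : ℕ} {α β : Type} {f : NodeFeature d α} (hf : ACRFeature f)
    (g : α → β) : ACRFeature (fun V _ G v => g (f V G v) : NodeFeature d β) := by
  obtain ⟨n, Ls, h, hh⟩ := hf
  exact ⟨n, Ls, fun x => g (h x), fun V _ G v => congrArg g (hh V G v)⟩

/-- Finite multisets over a countable type are countable, so they can be coded injectively by real
numbers. A single layer can therefore pass on everything it receives; deciding what to keep is left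
to `ACRFeature.map`. -/
theorem ACRFeature.step {d : ℕ} {α : Type} [Countable α] [Nonempty α] {f : NodeFeature d α}
    (hf : ACRFeature f) :
    ACRFeature (fun V _ G v => (f V G v, f.nbrs V G v, f.all V G v) :
      NodeFeature d (α × Multiset α × Multiset α)) := by
  obtain ⟨n, Ls, g, hg⟩ := hf
  obtain ⟨e₁, d₁, h₁⟩ := exists_real_coding (Multiset α)
  obtain ⟨e₂, d₂, h₂⟩ := exists_real_coding (α × Multiset α × Multiset α)
  let B : ACRLayer n 1 :=
    { aggDim := 1
      readDim := 1
      agg := fun M => e₁ (M.map g)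
      read := fun M => e₁ (M.map g)
      comb := fun x a r => e₂ (g x, d₁ a, d₁ r) }
  refine ⟨1, Ls.snoc B, d₂, fun V _ G v => ?_⟩
  rw [ACRLayers.apply_snoc]
  have hf' : f V G = fun v => g (Ls.apply G.toSimpleGraph
    (fun w i => if G.label w i then 1 else 0) v) := funext fun v => hg V G v
  simp only [ACRLayer.apply, B, h₁, h₂, Multiset.map_map, NodeFeature.nbrs, NodeFeature.all,
    hf', Function.comp_def]

theorem ACRFeature.acrExpressible {d : ℕ} {A : NodeClassifier d} {f : NodeFeature d Prop}
    (hf : ACRFeature f)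
    (h : ∀ (V : Type) [Fintype V] (G : LabelledGraph d V) (v : V), f V G v ↔ A V G v) :
    ACRExpressible A := by
  classical
  obtain ⟨n, Ls, g, hg⟩ := hf
  refine ⟨⟨n, Ls, fun x => decide (g x)⟩, fun V _ G v => ?_⟩
  rw [← h, hg]
  simp [ACRGNN.classifier]

/-! ### First-order axioms for gadgetised linear orders -/

section

variable {V W : Type}

/-- `u`, `a`, `b`, `w` are the nodes of a gadget that represents the directed edge `(u, w)`. -/
def LabelledGraph.Path (G : LabelledGraph 3 V) (u a b w : V) : Prop :=
  G.label u 0 = true ∧ G.label a 1 = true ∧ G.label b 2 = true ∧ G.label w 0 = true ∧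
    G.Adj u a ∧ G.Adj a b ∧ G.Adj b w

/-- First-order axioms of the gadgetisations of strict linear orders. -/
structure LabelledGraph.IsGadLin (G : LabelledGraph 3 V) : Prop where
  label_cases : ∀ v, (G.label v 0 = true ∧ ¬ G.label v 1 = true ∧ ¬ G.label v 2 = true) ∨
    (¬ G.label v 0 = true ∧ G.label v 1 = true ∧ ¬ G.label v 2 = true) ∨
    (¬ G.label v 0 = true ∧ ¬ G.label v 1 = true ∧ G.label v 2 = true)
  path_of_two : ∀ a, G.label a 1 = true → ∃ u b w, G.Path u a b w
  path_of_three : ∀ b, G.label b 2 = true → ∃ u a w, G.Path u a b w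
  adj_two : ∀ u a b w, G.Path u a b w → ∀ x, G.Adj a x → x = u ∨ x = b
  adj_three : ∀ u a b w, G.Path u a b w → ∀ x, G.Adj b x → x = a ∨ x = w
  not_adj_one : ∀ x y, G.label x 0 = true → G.label y 0 = true → ¬ G.Adj x y
  unique : ∀ u a b w a' b', G.Path u a b w → G.Path u a' b' w → a = a'
  irrefl : ∀ u a b, ¬ G.Path u a b u
  trans : ∀ u a b w a' b' x, G.Path u a b w → G.Path w a' b' x → ∃ a'' b'', G.Path u a'' b'' x
  total : ∀ u w, G.label u 0 = true → G.label w 0 = true → ¬ u = w →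
    ∃ a b, G.Path u a b w ∨ G.Path w a b u

theorem isGadLin_gad {d : ℕ} (D : LabelledDigraph d W) (hD : IsStrictTotalOrder W D.edge) :
    (gad D).IsGadLin := by
  -- Labels fix the constructors of the four nodes, and the middle adjacency forces both gadget
  -- nodes to belong to the same edge; all axioms reduce to this.
  have path : ∀ x a b y, (gad D).Path x a b y →
      ∃ u w h, x = .one u ∧ a = .two u w h ∧ b = .three u w h ∧ y = .one w := by
    rintro x a b y ⟨hx, ha, hb, hy, h₁, h₂, h₃⟩
    rcases x with u | ⟨_, _, _⟩ | ⟨_, _, _⟩ <;> simp [gad] at hx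
    rcases a with _ | ⟨u', w, h⟩ | ⟨_, _, _⟩ <;> simp [gad] at ha
    rcases b with _ | ⟨_, _, _⟩ | ⟨u'', w'', h''⟩ <;> simp [gad] at hb
    rcases y with w' | ⟨_, _, _⟩ | ⟨_, _, _⟩ <;> simp [gad] at hy
    rcases h₁ with h₁ | h₁ <;> cases h₁
    rcases h₂ with h₂ | h₂ <;> cases h₂
    rcases h₃ with h₃ | h₃ <;> cases h₃
    exact ⟨_, _, h, rfl, rfl, rfl, rfl⟩
  have mk : ∀ u w h, (gad D).Path (.one u) (.two u w h) (.three u w h) (.one w) := fun u w h =>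
    ⟨rfl, rfl, rfl, rfl, .inl (.first u w h), .inl (.second u w h), .inl (.third u w h)⟩
  refine ⟨?_, ?_, ?_, ?_, ?_, ?_, ?_, ?_, ?_, ?_⟩
  · rintro (_ | ⟨_, _, _⟩ | ⟨_, _, _⟩) <;> simp [gad]
  · rintro (_ | ⟨u, w, h⟩ | ⟨_, _, _⟩) ha <;> simp [gad] at ha
    exact ⟨_, _, _, mk u w h⟩
  · rintro (_ | ⟨_, _, _⟩ | ⟨u, w, h⟩) ha <;> simp [gad] at ha
    exact ⟨_, _, _, mk u w h⟩
  · intro x a b y hp z hz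
    obtain ⟨u, w, h, rfl, rfl, rfl, rfl⟩ := path _ _ _ _ hp
    rcases hz with hz | hz <;> cases hz <;> simp
  · intro x a b y hp z hz
    obtain ⟨u, w, h, rfl, rfl, rfl, rfl⟩ := path _ _ _ _ hp
    rcases hz with hz | hz <;> cases hz <;> simp
  · rintro (_ | ⟨_, _, _⟩ | ⟨_, _, _⟩) (_ | ⟨_, _, _⟩ | ⟨_, _, _⟩) hx hy h <;>
      simp [gad] at hx hy
    rcases h with h | h <;> cases h
  · intro x a b y a' b' hp hp'
    obtain ⟨u, w, h, rfl, rfl, rfl, rfl⟩ := path _ _ _ _ hp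
    obtain ⟨u', w', h', hu, rfl, rfl, hw⟩ := path _ _ _ _ hp'
    cases hu; cases hw; rfl
  · intro x a b hp
    obtain ⟨u, w, h, rfl, rfl, rfl, hw⟩ := path _ _ _ _ hp
    cases hw
    exact D.irrefl _ h
  · intro x a b y a' b' z hp hp'
    obtain ⟨u, w, h, rfl, rfl, rfl, rfl⟩ := path _ _ _ _ hp
    obtain ⟨u', w', h', hu, rfl, rfl, rfl⟩ := path _ _ _ _ hp'
    cases hu
    exact ⟨_, _, mk u w' (hD.trans _ _ _ h h')⟩
  · rintro (u | ⟨_, _, _⟩ | ⟨_, _, _⟩) (w | ⟨_, _, _⟩ | ⟨_, _, _⟩) hx hy hne <;>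
      simp [gad] at hx hy hne
    rcases (trichotomous_of D.edge u w) with h | h | h
    · exact ⟨_, _, .inl (mk u w h)⟩
    · exact absurd h hne
    · exact ⟨_, _, .inr (mk w u h)⟩

theorem LabelledGraph.IsGadLin.of_isIso {G : LabelledGraph 3 V} {H : LabelledGraph 3 W}
    (h : G.IsIso H) (hH : H.IsGadLin) : G.IsGadLin := by
  obtain ⟨f, hf⟩ := h
  have path : ∀ u a b w, H.Path (f u) (f a) (f b) (f w) ↔ G.Path u a b w := fun u a b w => by
    simp only [LabelledGraph.Path, hf, f.map_adj_iff]
  refine ⟨?_, ?_, ?_, ?_, ?_, ?_, ?_, ?_, ?_, ?_⟩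
  · intro v
    simpa only [hf] using hH.label_cases (f v)
  · intro a ha
    simpa only [f.surjective.exists, path] using hH.path_of_two (f a) (by rwa [hf])
  · intro a ha
    simpa only [f.surjective.exists, path] using hH.path_of_three (f a) (by rwa [hf])
  · intro u a b w hp x hx
    simpa using hH.adj_two _ _ _ _ ((path _ _ _ _).2 hp) (f x) (f.map_adj_iff.2 hx)
  · intro u a b w hp x hx
    simpa using hH.adj_three _ _ _ _ ((path _ _ _ _).2 hp) (f x) (f.map_adj_iff.2 hx)
  · intro x y hx hy hxy
    exact hH.not_adj_one (f x) (f y) (by rwa [hf]) (by rwa [hf]) (f.map_adj_iff.2 hxy)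
  · intro u a b w a' b' hp hp'
    exact f.injective
      (hH.unique _ _ _ _ _ _ ((path _ _ _ _).2 hp) ((path _ _ _ _).2 hp'))
  · intro u a b hp
    exact hH.irrefl _ _ _ ((path _ _ _ _).2 hp)
  · intro u a b w a' b' x hp hp'
    simpa only [f.surjective.exists, path] using
      hH.trans _ _ _ _ _ _ _ ((path _ _ _ _).2 hp) ((path _ _ _ _).2 hp')
  · intro u w hu hw hne
    simpa only [f.surjective.exists, path] using
      hH.total (f u) (f w) (by rwa [hf]) (by rwa [hf]) (fun h => hne (f.injective h))

namespace LabelledGraph.IsGadLin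

theorem label_eq {G : LabelledGraph 3 V} (hG : G.IsGadLin) (v : V) :
    (G.label v 0 = true → G.label v = ![true, false, false]) ∧
    (G.label v 1 = true → G.label v = ![false, true, false]) ∧
    (G.label v 2 = true → G.label v = ![false, false, true]) := by
  refine ⟨fun h => ?_, fun h => ?_, fun h => ?_⟩ <;> ext i <;> fin_cases i <;>
    have := hG.label_cases v <;> simp_all

/-- A gadget node has only the two neighbours on its path, and these carry different labels, so the
label singles out which one is meant. -/
theorem path_unique {G : LabelledGraph 3 V} (hG : G.IsGadLin) {u a b w u' b' w' : V}
    (h : G.Path u a b w) (h' : G.Path u' a b' w') : u = u' ∧ b = b' ∧ w = w' := by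
  obtain ⟨hu, ha, hb, hw, h₁, h₂, h₃⟩ := id h
  obtain ⟨hu', ha', hb', hw', h₁', h₂', h₃'⟩ := id h'
  have e₁ : u = u' := by
    rcases hG.adj_two _ _ _ _ h u' h₁'.symm with rfl | rfl
    · rfl
    · have := (hG.label_eq u').1 hu'
      simp_all
  have e₂ : b = b' := by
    rcases hG.adj_two _ _ _ _ h b' h₂' with rfl | rfl
    · have := (hG.label_eq b').1 hu
      simp_all
    · rfl
  subst e₂
  refine ⟨e₁, rfl, ?_⟩
  rcases hG.adj_three _ _ _ _ h w' h₃' with rfl | rfl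
  · have := (hG.label_eq w').1 hw'
    simp_all
  · rfl

theorem path_unique' {G : LabelledGraph 3 V} (hG : G.IsGadLin) {u a b w u' a' w' : V}
    (h : G.Path u a b w) (h' : G.Path u' a' b w') : a = a' := by
  rcases hG.adj_three _ _ _ _ h a' h'.2.2.2.2.2.1.symm with rfl | rfl
  · rfl
  · have := (hG.label_eq a').1 h.2.2.2.1
    have := h'.2.1
    simp_all

/-- The directed graph that is represented by a gadgetisation. -/
def digraph {G : LabelledGraph 3 V} (hG : G.IsGadLin) :
    LabelledDigraph 0 {v // G.label v 0 = true} where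
  edge u w := ∃ a b, G.Path u a b w
  irrefl u h := by
    obtain ⟨a, b, h⟩ := h
    exact hG.irrefl _ _ _ h
  label _ i := i.elim0

theorem isStrictTotalOrder_digraph {G : LabelledGraph 3 V} (hG : G.IsGadLin) :
    IsStrictTotalOrder _ hG.digraph.edge where
  irrefl := hG.digraph.irrefl
  trans := by
    rintro u v w ⟨a, b, h⟩ ⟨a', b', h'⟩
    exact hG.trans _ _ _ _ _ _ _ h h'
  trichotomous := by
    intro u w h h'
    by_contra hne
    obtain ⟨a, b, hp | hp⟩ := hG.total u w u.2 w.2 (fun e => hne (Subtype.ext e))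
    · exact h ⟨a, b, hp⟩
    · exact h' ⟨a, b, hp⟩

/-- The node of the graph that corresponds to a node of the gadgetisation. -/
noncomputable def ofGadNode {G : LabelledGraph 3 V} (hG : G.IsGadLin) : GadNode hG.digraph → V
  | .one u => u
  | .two _ _ h => h.choose
  | .three _ _ h => h.choose_spec.choose

theorem path_ofGadNode {G : LabelledGraph 3 V} (hG : G.IsGadLin) (u w) (h : hG.digraph.edge u w) :
    G.Path u (hG.ofGadNode (.two u w h)) (hG.ofGadNode (.three u w h)) w :=
  h.choose_spec.choose_spec

theorem label_ofGadNode {G : LabelledGraph 3 V} (hG : G.IsGadLin) (x : GadNode hG.digraph) :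
    G.label (hG.ofGadNode x) = (gad hG.digraph).label x := by
  rcases x with u | ⟨u, w, h⟩ | ⟨u, w, h⟩
  · exact (hG.label_eq _).1 u.2
  · exact (hG.label_eq _).2.1 (hG.path_ofGadNode u w h).2.1
  · exact (hG.label_eq _).2.2 (hG.path_ofGadNode u w h).2.2.1

/-- A gadget node determines its edge, which gives injectivity. Surjectivity rests on the axiom
`unique`: an edge has only one gadget, so the arbitrarily chosen one is the given one. -/
theorem ofGadNode_bijective {G : LabelledGraph 3 V} (hG : G.IsGadLin) :
    Function.Bijective hG.ofGadNode := by
  constructor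
  · intro x y hxy
    have hl : (gad hG.digraph).label x = (gad hG.digraph).label y := by
      rw [← label_ofGadNode, ← label_ofGadNode, hxy]
    rcases x with u | ⟨u, w, h⟩ | ⟨u, w, h⟩ <;> rcases y with u' | ⟨u', w', h'⟩ | ⟨u', w', h'⟩ <;>
      simp [gad] at hl
    · exact congrArg _ (Subtype.ext hxy)
    · have hp := hG.path_ofGadNode u w h
      rw [hxy] at hp
      obtain ⟨e₁, -, e₂⟩ := hG.path_unique hp (hG.path_ofGadNode u' w' h')
      obtain rfl := Subtype.ext e₁
      obtain rfl := Subtype.ext e₂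
      rfl
    · have hp := hG.path_ofGadNode u w h
      rw [hxy] at hp
      have ha := hG.path_unique' hp (hG.path_ofGadNode u' w' h')
      rw [ha] at hp
      obtain ⟨e₁, -, e₂⟩ := hG.path_unique hp (hG.path_ofGadNode u' w' h')
      obtain rfl := Subtype.ext e₁
      obtain rfl := Subtype.ext e₂
      rfl
  · intro v
    rcases hG.label_cases v with h | h | h
    · exact ⟨.one ⟨v, h.1⟩, rfl⟩
    · obtain ⟨u, b, w, hp⟩ := hG.path_of_two v h.2.1
      let e : hG.digraph.edge ⟨u, hp.1⟩ ⟨w, hp.2.2.2.1⟩ := ⟨v, b, hp⟩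
      exact ⟨.two _ _ e, hG.unique _ _ _ _ _ _ (hG.path_ofGadNode _ _ e) hp⟩
    · obtain ⟨u, a, w, hp⟩ := hG.path_of_three v h.2.2
      let e : hG.digraph.edge ⟨u, hp.1⟩ ⟨w, hp.2.2.2.1⟩ := ⟨a, v, hp⟩
      have hp' := hG.path_ofGadNode _ _ e
      have ha := hG.unique _ _ _ _ _ _ hp' hp
      rw [ha] at hp'
      exact ⟨.three _ _ e, (hG.path_unique hp' hp).2.1⟩

/-- No two nodes of the first kind are adjacent, so every edge has an end inside a gadget, where the
axioms list all neighbours. -/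
theorem adj_ofGadNode {G : LabelledGraph 3 V} (hG : G.IsGadLin) {x y : GadNode hG.digraph} :
    G.Adj (hG.ofGadNode x) (hG.ofGadNode y) ↔ (gad hG.digraph).Adj x y := by
  have key : ∀ x y, GadEdge hG.digraph x y → G.Adj (hG.ofGadNode x) (hG.ofGadNode y) := by
    intro x y h
    rcases h with ⟨u, w, h⟩ | ⟨u, w, h⟩ | ⟨u, w, h⟩
    · exact (hG.path_ofGadNode u w h).2.2.2.2.1
    · exact (hG.path_ofGadNode u w h).2.2.2.2.2.1
    · exact (hG.path_ofGadNode u w h).2.2.2.2.2.2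
  have two : ∀ u w h y, G.Adj (hG.ofGadNode (.two u w h)) (hG.ofGadNode y) →
      (gad hG.digraph).Adj (.two u w h) y := by
    intro u w h y hxy
    rcases hG.adj_two _ _ _ _ (hG.path_ofGadNode u w h) _ hxy with e | e
    · obtain rfl := hG.ofGadNode_bijective.1 (a₂ := .one u) e
      exact .inr (.first u w h)
    · obtain rfl := hG.ofGadNode_bijective.1 e
      exact .inl (.second u w h)
  have three : ∀ u w h y, G.Adj (hG.ofGadNode (.three u w h)) (hG.ofGadNode y) →
      (gad hG.digraph).Adj (.three u w h) y := by
    intro u w h y hxy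
    rcases hG.adj_three _ _ _ _ (hG.path_ofGadNode u w h) _ hxy with e | e
    · obtain rfl := hG.ofGadNode_bijective.1 e
      exact .inr (.second u w h)
    · obtain rfl := hG.ofGadNode_bijective.1 (a₂ := .one w) e
      exact .inl (.third u w h)
  refine ⟨fun hxy => ?_, fun h => h.elim (key x y) fun h => (key y x h).symm⟩
  rcases x with u | ⟨u, w, h⟩ | ⟨u, w, h⟩
  · rcases y with u' | ⟨u', w', h'⟩ | ⟨u', w', h'⟩
    · exact absurd hxy (hG.not_adj_one _ _ u.2 u'.2)
    · exact (two _ _ _ _ hxy.symm).symm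
    · exact (three _ _ _ _ hxy.symm).symm
  · exact two _ _ _ _ hxy
  · exact three _ _ _ _ hxy

theorem isIso_gad {G : LabelledGraph 3 V} (hG : G.IsGadLin) : G.IsIso (gad hG.digraph) := by
  let f : (gad hG.digraph).toSimpleGraph ≃g G.toSimpleGraph :=
    { Equiv.ofBijective _ hG.ofGadNode_bijective with map_rel_iff' := hG.adj_ofGadNode }
  refine ⟨f.symm, fun v => ?_⟩
  obtain ⟨x, rfl⟩ := f.surjective v
  rw [f.symm_apply_apply]
  exact (hG.label_ofGadNode x).symm

end LabelledGraph.IsGadLin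

theorem gadLin_iff (V : Type) [Fintype V] (G : LabelledGraph 3 V) (v : V) :
    gadLin V G v ↔ G.IsGadLin :=
  ⟨fun ⟨_, _, _, D, hD, h⟩ => .of_isIso h (isGadLin_gad D hD),
    -- Dimension `0` suffices because `gad` ignores the labels of the directed graph.
    fun h => ⟨0, _, inferInstance, _, h.isStrictTotalOrder_digraph, h.isIso_gad⟩⟩

end

/-! ### Recognising gadgetised linear orders by degrees -/

open Classical in
/-- The neighbours of a node whose label has a `1` at position `i`. -/
noncomputable def LabelledGraph.labelNbrs {d : ℕ} {V : Type} [Fintype V] (G : LabelledGraph d V)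
    (i : Fin d) (v : V) : Finset V :=
  Finset.univ.filter fun w => G.Adj v w ∧ G.label w i = true

/-- The label travels with the feature, so that the received multiset can be split by the kind of
neighbour. -/
theorem ACRFeature.gather {d : ℕ} {α : Type} [Countable α] [Nonempty α] {f : NodeFeature d α}
    (hf : ACRFeature (fun V _ G v => (G.label v, f V G v))) :
    ACRFeature (fun V _ G v => (G.label v, f V G v, fun i => (G.labelNbrs i v).val.map (f V G)) :
      NodeFeature d ((Fin d → Bool) × α × (Fin d → Multiset α))) := by
  have h := hf.step.map fun x => (x.1.1, x.1.2, fun i =>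
    (x.2.1.filter fun y => y.1 i = true).map Prod.snd)
  refine cast (congrArg _ ?_) h
  funext V _ G v
  refine Prod.ext rfl (Prod.ext rfl ?_)
  funext i
  simp only [NodeFeature.nbrs, Multiset.filter_map, Multiset.map_map, Function.comp_def,
    LabelledGraph.labelNbrs, ← Finset.filter_val, Finset.filter_filter]

namespace LabelledGraph

variable {V : Type} [Fintype V]

/-- In a gadgetisation: the number of successors of a node of the directed graph. -/
noncomputable def outDegree (G : LabelledGraph 3 V) (v : V) : ℕ := (G.labelNbrs 1 v).card

/-- The out-degree of the node of the directed graph next to a node labelled `(0,0,1)`. -/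
noncomputable def threeDegree (G : LabelledGraph 3 V) (v : V) : ℕ :=
  ((G.labelNbrs 0 v).val.map G.outDegree).sum

/-- The out-degree of the target of the gadget of a node labelled `(0,1,0)`. -/
noncomputable def twoDegree (G : LabelledGraph 3 V) (v : V) : ℕ :=
  ((G.labelNbrs 2 v).val.map G.threeDegree).sum

/-- The condition on the labels of a node and its neighbours in a gadgetisation. -/
def LocalCondition (l : Fin 3 → Bool) (c : Fin 3 → ℕ) : Prop :=
  ((l 0 = true ∧ ¬ l 1 = true ∧ ¬ l 2 = true) ∨ (¬ l 0 = true ∧ l 1 = true ∧ ¬ l 2 = true) ∨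
    (¬ l 0 = true ∧ ¬ l 1 = true ∧ l 2 = true)) ∧
  (l 0 = true → c 0 = 0) ∧ (l 1 = true → c 0 = 1 ∧ c 1 = 0 ∧ c 2 = 1) ∧
  (l 2 = true → c 0 = 1 ∧ c 1 = 1 ∧ c 2 = 0)

/-- The characterisation of gadgetised linear orders by means of degrees. -/
structure DegreeCondition (G : LabelledGraph 3 V) : Prop where
  localCond : ∀ v, LocalCondition (G.label v) fun i => (G.labelNbrs i v).card
  succ : ∀ v, G.label v 0 = true →
    (G.labelNbrs 1 v).val.map G.twoDegree = Multiset.range (G.outDegree v)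
  injOn : ∀ v w, G.label v 0 = true → G.label w 0 = true → G.outDegree v = G.outDegree w → v = w

theorem mem_labelNbrs {d : ℕ} {G : LabelledGraph d V} {i : Fin d} {v w : V} :
    w ∈ G.labelNbrs i v ↔ G.Adj v w ∧ G.label w i = true := by
  simp [labelNbrs]

/-- The sums in `twoDegree` and `threeDegree` are total substitutes for "the value at the unique
neighbour", and return it when there is one. -/
theorem twoDegree_eq {G : LabelledGraph 3 V} {a b w : V} (h : G.labelNbrs 2 a = {b})
    (h' : G.labelNbrs 0 b = {w}) : G.twoDegree a = G.outDegree w := by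
  simp [twoDegree, threeDegree, h, h']

theorem DegreeCondition.twoDegree_eq {G : LabelledGraph 3 V} (hG : G.DegreeCondition)
    {u a b w : V} (h : G.Path u a b w) : G.twoDegree a = G.outDegree w := by
  obtain ⟨hu, ha, hb, hw, h₁, h₂, h₃⟩ := h
  obtain ⟨b', hb'⟩ := Finset.card_eq_one.1 ((hG.localCond a).2.2.1 ha).2.2
  obtain ⟨w', hw'⟩ := Finset.card_eq_one.1 ((hG.localCond b).2.2.2 hb).1
  obtain rfl : b = b' := by simpa [hb'] using mem_labelNbrs.2 ⟨h₂, hb⟩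
  obtain rfl : w = w' := by simpa [hw'] using mem_labelNbrs.2 ⟨h₃, hw⟩
  exact LabelledGraph.twoDegree_eq hb' hw'

theorem DegreeCondition.path_of_two {G : LabelledGraph 3 V} (hG : G.DegreeCondition) {a : V}
    (ha : G.label a 1 = true) : ∃ u b w, G.Path u a b w := by
  obtain ⟨h0, -, h2⟩ := (hG.localCond a).2.2.1 ha
  obtain ⟨u, hu⟩ := Finset.card_pos.1 (h0.symm ▸ Nat.one_pos)
  obtain ⟨b, hb⟩ := Finset.card_pos.1 (h2.symm ▸ Nat.one_pos)
  rw [mem_labelNbrs] at hu hb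
  obtain ⟨w, hw⟩ := Finset.card_pos.1 (((hG.localCond b).2.2.2 hb.2).1.symm ▸ Nat.one_pos)
  rw [mem_labelNbrs] at hw
  exact ⟨u, b, w, hu.2, ha, hb.2, hw.2, hu.1.symm, hb.1, hw.1⟩

theorem DegreeCondition.eq_of_adj {G : LabelledGraph 3 V} {i : Fin 3} {v x y : V}
    (h : (G.labelNbrs i v).card = 1) (hx : G.Adj v x) (hxi : G.label x i = true)
    (hy : G.Adj v y) (hyi : G.label y i = true) : x = y :=
  Finset.card_le_one.1 h.le x (mem_labelNbrs.2 ⟨hx, hxi⟩) y (mem_labelNbrs.2 ⟨hy, hyi⟩)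

theorem not_adj_of_card_eq_zero {d : ℕ} {G : LabelledGraph d V} {i : Fin d} {v x : V}
    (h : (G.labelNbrs i v).card = 0) (hxi : G.label x i = true) : ¬ G.Adj v x := fun hx => by
  have := mem_labelNbrs.2 ⟨hx, hxi⟩
  simp_all

/-- The out-degree of `w` lies in the range realised by the successors of `u`; by injectivity the
successor realising it is `w`. -/
theorem DegreeCondition.exists_path {G : LabelledGraph 3 V} (hG : G.DegreeCondition) {u w : V}
    (hu : G.label u 0 = true) (hw : G.label w 0 = true) (h : G.outDegree w < G.outDegree u) :
    ∃ a b, G.Path u a b w := by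
  rw [← Multiset.mem_range, ← hG.succ u hu, Multiset.mem_map] at h
  obtain ⟨a, ha, hd⟩ := h
  obtain ⟨hua, ha⟩ := mem_labelNbrs.1 ha
  obtain ⟨u', b, w', hp⟩ := hG.path_of_two ha
  obtain rfl : u' = u := eq_of_adj ((hG.localCond a).2.2.1 ha).1 hp.2.2.2.2.1.symm hp.1 hua.symm hu
  obtain rfl : w' = w := hG.injOn _ _ hp.2.2.2.1 hw (by rw [← hG.twoDegree_eq hp, hd])
  exact ⟨a, b, hp⟩

theorem DegreeCondition.outDegree_lt {G : LabelledGraph 3 V} (hG : G.DegreeCondition)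
    {u a b w : V} (h : G.Path u a b w) : G.outDegree w < G.outDegree u := by
  rw [← Multiset.mem_range, ← hG.succ u h.1, ← hG.twoDegree_eq h]
  exact Multiset.mem_map_of_mem _ (mem_labelNbrs.2 ⟨h.2.2.2.2.1, h.2.1⟩)

theorem DegreeCondition.isGadLin {G : LabelledGraph 3 V} (hG : G.DegreeCondition) :
    G.IsGadLin where
  label_cases v := (hG.localCond v).1
  path_of_two a ha := hG.path_of_two ha
  path_of_three b hb := by
    obtain ⟨a, ha⟩ := Finset.card_pos.1 (((hG.localCond b).2.2.2 hb).2.1.symm ▸ Nat.one_pos)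
    obtain ⟨hba, ha⟩ := mem_labelNbrs.1 ha
    obtain ⟨u, b', w, hp⟩ := hG.path_of_two ha
    obtain rfl : b' = b := eq_of_adj ((hG.localCond a).2.2.1 ha).2.2
      hp.2.2.2.2.2.1 hp.2.2.1 hba.symm hb
    exact ⟨u, a, w, hp⟩
  adj_two u a b w hp x hx := by
    obtain ⟨hu, ha, hb, hw, h₁, h₂, h₃⟩ := hp
    obtain ⟨c0, c1, c2⟩ := (hG.localCond a).2.2.1 ha
    rcases (hG.localCond x).1 with h | h | h
    · exact .inl (eq_of_adj c0 hx h.1 h₁.symm hu)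
    · exact absurd hx (not_adj_of_card_eq_zero c1 h.2.1)
    · exact .inr (eq_of_adj c2 hx h.2.2 h₂ hb)
  adj_three u a b w hp x hx := by
    obtain ⟨hu, ha, hb, hw, h₁, h₂, h₃⟩ := hp
    obtain ⟨c0, c1, c2⟩ := (hG.localCond b).2.2.2 hb
    rcases (hG.localCond x).1 with h | h | h
    · exact .inr (eq_of_adj c0 hx h.1 h₃ hw)
    · exact .inl (eq_of_adj c1 hx h.2.1 h₂.symm ha)
    · exact absurd hx (not_adj_of_card_eq_zero c2 h.2.2)
  not_adj_one x y hx hy := not_adj_of_card_eq_zero ((hG.localCond x).2.1 hx) hy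
  unique u a b w a' b' h h' := by
    -- A range has no repetitions, so parallel gadgets, whose targets have equal out-degree, are
    -- excluded.
    have hd : ((G.labelNbrs 1 u).val.map G.twoDegree).Nodup := by
      rw [hG.succ u h.1]
      exact Multiset.nodup_range _
    exact Multiset.inj_on_of_nodup_map hd a (mem_labelNbrs.2 ⟨h.2.2.2.2.1, h.2.1⟩) a'
      (mem_labelNbrs.2 ⟨h'.2.2.2.2.1, h'.2.1⟩) (by rw [hG.twoDegree_eq h, hG.twoDegree_eq h'])
  irrefl u a b h := (hG.outDegree_lt h).false
  trans u a b w a' b' x h h' :=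
    hG.exists_path h.1 h'.2.2.2.1 ((hG.outDegree_lt h').trans (hG.outDegree_lt h))
  total u w hu hw hne := by
    rcases lt_trichotomy (G.outDegree u) (G.outDegree w) with h | h | h
    · obtain ⟨a, b, h⟩ := hG.exists_path hw hu h
      exact ⟨a, b, .inr h⟩
    · exact absurd (hG.injOn u w hu hw h) hne
    · obtain ⟨a, b, h⟩ := hG.exists_path hu hw h
      exact ⟨a, b, .inl h⟩

namespace IsGadLin

theorem not_label {V : Type} {G : LabelledGraph 3 V} (hG : G.IsGadLin) {v : V} {i j : Fin 3}
    (hi : G.label v i = true) (hij : i ≠ j) : ¬ G.label v j = true := by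
  have := hG.label_cases v
  fin_cases i <;> fin_cases j <;> simp_all

theorem labelNbrs_two {G : LabelledGraph 3 V} (hG : G.IsGadLin) {u a b w : V}
    (h : G.Path u a b w) :
    G.labelNbrs 0 a = {u} ∧ G.labelNbrs 1 a = ∅ ∧ G.labelNbrs 2 a = {b} := by
  have := hG.adj_two _ _ _ _ h
  obtain ⟨h0, h1, h2, h3, h4, h5, h6⟩ := h
  refine ⟨?_, ?_, ?_⟩ <;> ext x <;> simp only [mem_labelNbrs, Finset.mem_singleton,
    Finset.notMem_empty, iff_false, not_and]
  · refine ⟨fun hx => (this x hx.1).resolve_right ?_, ?_⟩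
    · rintro rfl
      exact hG.not_label h2 (by decide) hx.2
    · rintro rfl
      exact ⟨h4.symm, h0⟩
  · rintro hx
    obtain rfl | rfl := this x hx
    · exact hG.not_label h0 (by decide)
    · exact hG.not_label h2 (by decide)
  · refine ⟨fun hx => (this x hx.1).resolve_left ?_, ?_⟩
    · rintro rfl
      exact hG.not_label h0 (by decide) hx.2
    · rintro rfl
      exact ⟨h5, h2⟩

theorem labelNbrs_three {G : LabelledGraph 3 V} (hG : G.IsGadLin) {u a b w : V}
    (h : G.Path u a b w) :
    G.labelNbrs 0 b = {w} ∧ G.labelNbrs 1 b = {a} ∧ G.labelNbrs 2 b = ∅ := by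
  have := hG.adj_three _ _ _ _ h
  obtain ⟨h0, h1, h2, h3, h4, h5, h6⟩ := h
  refine ⟨?_, ?_, ?_⟩ <;> ext x <;> simp only [mem_labelNbrs, Finset.mem_singleton,
    Finset.notMem_empty, iff_false, not_and]
  · refine ⟨fun hx => (this x hx.1).resolve_left ?_, ?_⟩
    · rintro rfl
      exact hG.not_label h1 (by decide) hx.2
    · rintro rfl
      exact ⟨h6, h3⟩
  · refine ⟨fun hx => (this x hx.1).resolve_right ?_, ?_⟩
    · rintro rfl
      exact hG.not_label h3 (by decide) hx.2
    · rintro rfl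
      exact ⟨h5.symm, h1⟩
  · rintro hx
    obtain rfl | rfl := this x hx
    · exact hG.not_label h1 (by decide)
    · exact hG.not_label h3 (by decide)

theorem exists_path {G : LabelledGraph 3 V} (hG : G.IsGadLin) {u a : V}
    (hu : G.label u 0 = true) (ha : a ∈ G.labelNbrs 1 u) : ∃ b w, G.Path u a b w := by
  obtain ⟨hua, ha⟩ := mem_labelNbrs.1 ha
  obtain ⟨u', b, w, hp⟩ := hG.path_of_two a ha
  have : u ∈ G.labelNbrs 0 a := mem_labelNbrs.2 ⟨hua.symm, hu⟩
  rw [(hG.labelNbrs_two hp).1, Finset.mem_singleton] at this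
  exact ⟨b, w, this ▸ hp⟩

theorem twoDegree_eq {G : LabelledGraph 3 V} (hG : G.IsGadLin) {u a b w : V}
    (h : G.Path u a b w) : G.twoDegree a = G.outDegree w :=
  LabelledGraph.twoDegree_eq (hG.labelNbrs_two h).2.2 (hG.labelNbrs_three h).1

-- Sending a gadget to its target is injective by `unique`, so counting gadgets at `u` counts its
-- successors.
open Classical in
theorem outDegree_eq {G : LabelledGraph 3 V} (hG : G.IsGadLin) {u : V}
    (hu : G.label u 0 = true) :
    G.outDegree u = (Finset.univ.filter fun w => ∃ a b, G.Path u a b w).card := by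
  have h : ∀ a, ∃ w, a ∈ G.labelNbrs 1 u → ∃ b, G.Path u a b w := fun a => by
    by_cases ha : a ∈ G.labelNbrs 1 u
    · obtain ⟨b, w, hp⟩ := hG.exists_path hu ha
      exact ⟨w, fun _ => ⟨b, hp⟩⟩
    · exact ⟨u, fun h => absurd h ha⟩
  choose t ht using h
  have hinj : Set.InjOn t (G.labelNbrs 1 u) := by
    intro a ha a' ha' e
    obtain ⟨b, hb⟩ := ht a ha
    obtain ⟨b', hb'⟩ := ht a' ha'
    rw [← e] at hb'
    exact hG.unique _ _ _ _ _ _ hb hb'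
  rw [outDegree, ← Finset.card_image_of_injOn hinj]
  congr 1
  ext w
  simp only [Finset.mem_image, Finset.mem_filter, Finset.mem_univ, true_and]
  constructor
  · rintro ⟨a, ha, rfl⟩
    exact ⟨a, ht a ha⟩
  · rintro ⟨a, b, hp⟩
    have ha : a ∈ G.labelNbrs 1 u := mem_labelNbrs.2 ⟨hp.2.2.2.2.1, hp.2.1⟩
    obtain ⟨b', hb'⟩ := ht a ha
    exact ⟨a, ha, (hG.path_unique hb' hp).2.2⟩

/-- By transitivity the successors of `w` are successors of `u`, and `w` itself is a further one. -/
theorem outDegree_lt {G : LabelledGraph 3 V} (hG : G.IsGadLin) {u a b w : V}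
    (h : G.Path u a b w) : G.outDegree w < G.outDegree u := by
  classical
  rw [hG.outDegree_eq h.1, hG.outDegree_eq h.2.2.2.1]
  refine Finset.card_lt_card (Finset.ssubset_iff_subset_ne.2 ⟨fun x hx => ?_, fun e => ?_⟩)
  · simp only [Finset.mem_filter, Finset.mem_univ, true_and] at hx ⊢
    obtain ⟨a', b', h'⟩ := hx
    exact hG.trans _ _ _ _ _ _ _ h h'
  · have : w ∈ Finset.univ.filter fun x => ∃ a b, G.Path u a b x := by
      simpa using ⟨a, b, h⟩
    rw [← e] at this
    simp only [Finset.mem_filter, Finset.mem_univ, true_and] at this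
    obtain ⟨a', b', h'⟩ := this
    exact hG.irrefl _ _ _ h'

theorem outDegree_injOn {G : LabelledGraph 3 V} (hG : G.IsGadLin) {u w : V}
    (hu : G.label u 0 = true) (hw : G.label w 0 = true) (h : G.outDegree u = G.outDegree w) :
    u = w := by
  by_contra hne
  obtain ⟨a, b, hp | hp⟩ := hG.total u w hu hw hne
  · exact (hG.outDegree_lt hp).ne' h
  · exact (hG.outDegree_lt hp).ne h

theorem degreeCondition {G : LabelledGraph 3 V} (hG : G.IsGadLin) : G.DegreeCondition where
  localCond v := by
    refine ⟨hG.label_cases v, fun h => ?_, fun h => ?_, fun h => ?_⟩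
    · refine Finset.card_eq_zero.2 (Finset.eq_empty_of_forall_notMem fun x hx => ?_)
      rw [mem_labelNbrs] at hx
      exact hG.not_adj_one v x h hx.2 hx.1
    · obtain ⟨u, b, w, hp⟩ := hG.path_of_two v h
      simp [hG.labelNbrs_two hp]
    · obtain ⟨u, a, w, hp⟩ := hG.path_of_three v h
      simp [hG.labelNbrs_three hp]
  succ u hu := by
    have hd : ((G.labelNbrs 1 u).val.map G.twoDegree).Nodup := by
      refine Multiset.Nodup.map_on (fun a ha a' ha' e => ?_) (G.labelNbrs 1 u).nodup
      obtain ⟨b, w, hp⟩ := hG.exists_path hu ha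
      obtain ⟨b', w', hp'⟩ := hG.exists_path hu ha'
      rw [hG.twoDegree_eq hp, hG.twoDegree_eq hp'] at e
      obtain rfl := hG.outDegree_injOn hp.2.2.2.1 hp'.2.2.2.1 e
      exact hG.unique _ _ _ _ _ _ hp hp'
    -- Distinct values below the out-degree of `u`, as many as that out-degree, must exhaust the
    -- range.
    refine Multiset.eq_of_le_of_card_le ((Multiset.le_iff_subset hd).2 fun x hx => ?_) ?_
    · obtain ⟨a, ha, rfl⟩ := Multiset.mem_map.1 hx
      obtain ⟨b, w, hp⟩ := hG.exists_path hu ha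
      rw [hG.twoDegree_eq hp, Multiset.mem_range]
      exact hG.outDegree_lt hp
    · simp [outDegree]
  injOn _ _ hu hw := hG.outDegree_injOn hu hw

end IsGadLin

end LabelledGraph

-- Out-degrees travel from sources of no gadget knowledge to the far end: from a target to its node
-- of the third kind, on to the second kind, and finally to the source of the edge. Four rounds
-- collect the local data, and one readout checks the global part.
open LabelledGraph in
theorem acrFeature_degreeCondition :
    ACRFeature (fun _ _ G _ => G.DegreeCondition : NodeFeature 3 Prop) := by
  have h₀ : ACRFeature (fun _ _ G v => (G.label v, ()) : NodeFeature 3 _) :=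
    (ACRFeature.label 3).map fun l => (l, ())
  have h₁ : ACRFeature (fun _ _ G v =>
      (G.label v, fun i => (G.labelNbrs i v).card) : NodeFeature 3 _) := by
    simpa using (ACRFeature.gather h₀).map fun x => (x.1, fun i => (x.2.2 i).card)
  have h₂ : ACRFeature (fun _ _ G v =>
      (G.label v, (fun i => (G.labelNbrs i v).card), G.threeDegree v) : NodeFeature 3 _) := by
    simpa [Multiset.map_map, Function.comp_def, threeDegree, outDegree] using (ACRFeature.gather h₁).map fun x =>
      (x.1, x.2.1, ((x.2.2 0).map fun c => c 1).sum)
  have h₃ : ACRFeature (fun _ _ G v =>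
      (G.label v, (fun i => (G.labelNbrs i v).card), G.twoDegree v) : NodeFeature 3 _) := by
    simpa [Multiset.map_map, Function.comp_def, twoDegree] using (ACRFeature.gather h₂).map fun x =>
      (x.1, x.2.1.1, ((x.2.2 2).map fun c => c.2).sum)
  have h₄ : ACRFeature (fun _ _ G v =>
      (G.label v, G.outDegree v, LocalCondition (G.label v) (fun i => (G.labelNbrs i v).card) ∧
        (G.label v 0 = true →
          (G.labelNbrs 1 v).val.map G.twoDegree = Multiset.range (G.outDegree v))) :
        NodeFeature 3 _) := by
    simpa [Multiset.map_map, Function.comp_def, outDegree] using (ACRFeature.gather h₃).map fun x =>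
      (x.1, x.2.1.1 1, LocalCondition x.1 x.2.1.1 ∧ (x.1 0 = true →
        ((x.2.2 1).map fun c => c.2) = Multiset.range (x.2.1.1 1)))
  -- Injectivity of out-degrees becomes absence of repetitions in a multiset, which a readout can
  -- test.
  refine cast (congrArg _ ?_) (h₄.step.map fun x => (∀ y ∈ x.2.2, y.2.2) ∧
    ((x.2.2.filter fun y => y.1 0 = true).map fun y => y.2.1).Nodup)
  funext V _ G v
  refine propext ⟨fun ⟨h, h'⟩ => ?_, fun h => ⟨?_, ?_⟩⟩
  · have h := fun v => h _ (Multiset.mem_map_of_mem _ (Finset.mem_univ_val v))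
    refine ⟨fun v => (h v).1, fun v => (h v).2, fun v w hv hw e => ?_⟩
    rw [NodeFeature.all, Multiset.filter_map, Multiset.map_map] at h'
    exact Multiset.inj_on_of_nodup_map h' v (by simpa using hv) w (by simpa using hw) e
  · intro y hy
    obtain ⟨v, -, rfl⟩ := Multiset.mem_map.1 hy
    exact ⟨h.localCond v, h.succ v⟩
  · rw [NodeFeature.all, Multiset.filter_map, Multiset.map_map]
    refine Multiset.Nodup.map_on (fun v hv w hw e => ?_) (Multiset.Nodup.filter _ Finset.univ.nodup)
    exact h.injOn v w (by simpa using hv) (by simpa using hw) e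

theorem acrExpressible_gadLin : ACRExpressible gadLin :=
  acrFeature_degreeCondition.acrExpressible fun V _ G v =>
    ⟨fun h => (gadLin_iff V G v).2 h.isGadLin, fun h => ((gadLin_iff V G v).1 h).degreeCondition⟩

/-! ### The defining first-order formula -/

namespace LabelledGraph

open FirstOrder Language

/-- The atomic formula for an edge between two quantified variables. -/
def edgeFormula {n : ℕ} (i j : Fin n) : (graphLanguage 3).BoundedFormula (Fin 1) n :=
  Relations.boundedFormula₂ (L := graphLanguage 3) (GraphRel.edge : GraphRel 3 2) (&i) (&j)

/-- The atomic formula for a label of a quantified variable. -/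
def labelFormula {n : ℕ} (p : Fin 3) (i : Fin n) : (graphLanguage 3).BoundedFormula (Fin 1) n :=
  Relations.boundedFormula₁ (L := graphLanguage 3) (GraphRel.label p : GraphRel 3 1) (&i)

/-- Equality of two quantified variables. -/
def equalFormula {n : ℕ} (i j : Fin n) : (graphLanguage 3).BoundedFormula (Fin 1) n :=
  Term.bdEqual (&i) (&j)

/-- The formula that defines `LabelledGraph.Path`. -/
def pathFormula {n : ℕ} (u a b w : Fin n) : (graphLanguage 3).BoundedFormula (Fin 1) n :=
  labelFormula 0 u ⊓ labelFormula 1 a ⊓ labelFormula 2 b ⊓ labelFormula 0 w ⊓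
    edgeFormula u a ⊓ edgeFormula a b ⊓ edgeFormula b w

/-- Satisfaction of a bounded formula in a graph. -/
def Models {V : Type} (G : LabelledGraph 3 V) (x : Fin 1 → V) {n : ℕ}
    (φ : (graphLanguage 3).BoundedFormula (Fin 1) n) (xs : Fin n → V) : Prop :=
  let _ := G.toStructure
  φ.Realize x xs

section

variable {V : Type} {G : LabelledGraph 3 V} {x : Fin 1 → V} {n : ℕ} {xs : Fin n → V}

theorem models_edgeFormula {i j : Fin n} :
    G.Models x (edgeFormula i j) xs ↔ G.Adj (xs i) (xs j) := by
  let _ := G.toStructure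
  exact BoundedFormula.realize_rel₂

theorem models_labelFormula {p : Fin 3} {i : Fin n} :
    G.Models x (labelFormula p i) xs ↔ G.label (xs i) p = true := by
  let _ := G.toStructure
  exact BoundedFormula.realize_rel₁

theorem models_equalFormula {i j : Fin n} :
    G.Models x (equalFormula i j) xs ↔ xs i = xs j := Iff.rfl

theorem models_inf {φ ψ : (graphLanguage 3).BoundedFormula (Fin 1) n} :
    G.Models x (φ ⊓ ψ) xs ↔ G.Models x φ xs ∧ G.Models x ψ xs := by
  let _ := G.toStructure
  exact BoundedFormula.realize_inf

theorem models_sup {φ ψ : (graphLanguage 3).BoundedFormula (Fin 1) n} :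
    G.Models x (φ ⊔ ψ) xs ↔ G.Models x φ xs ∨ G.Models x ψ xs := by
  let _ := G.toStructure
  exact BoundedFormula.realize_sup

theorem models_not {φ : (graphLanguage 3).BoundedFormula (Fin 1) n} :
    G.Models x (∼φ) xs ↔ ¬ G.Models x φ xs := by
  let _ := G.toStructure
  exact BoundedFormula.realize_not

theorem models_imp {φ ψ : (graphLanguage 3).BoundedFormula (Fin 1) n} :
    G.Models x (φ ⟹ ψ) xs ↔ (G.Models x φ xs → G.Models x ψ xs) := Iff.rfl

theorem models_all {φ : (graphLanguage 3).BoundedFormula (Fin 1) (n + 1)} :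
    G.Models x (∀' φ) xs ↔ ∀ a, G.Models x φ (Fin.snoc xs a) := Iff.rfl

theorem models_ex {φ : (graphLanguage 3).BoundedFormula (Fin 1) (n + 1)} :
    G.Models x (∃' φ) xs ↔ ∃ a, G.Models x φ (Fin.snoc xs a) := by
  let _ := G.toStructure
  exact BoundedFormula.realize_ex

theorem models_pathFormula {u a b w : Fin n} :
    G.Models x (pathFormula u a b w) xs ↔ G.Path (xs u) (xs a) (xs b) (xs w) := by
  simp only [pathFormula, models_inf, models_edgeFormula, models_labelFormula, Path, and_assoc]

end

/-- The conjunction of the axioms of gadgetised strict linear orders. -/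
def gadLinFormula : (graphLanguage 3).BoundedFormula (Fin 1) 0 :=
  (∀' ((labelFormula 0 0 ⊓ (∼(labelFormula 1 0) ⊓ ∼(labelFormula 2 0))) ⊔
    ((∼(labelFormula 0 0) ⊓ (labelFormula 1 0 ⊓ ∼(labelFormula 2 0))) ⊔
      (∼(labelFormula 0 0) ⊓ (∼(labelFormula 1 0) ⊓ labelFormula 2 (0 : Fin 1)))))) ⊓
  ((∀' (labelFormula 1 0 ⟹ ∃' ∃' ∃' pathFormula 1 0 2 (3 : Fin 4))) ⊓
  ((∀' (labelFormula 2 0 ⟹ ∃' ∃' ∃' pathFormula 1 2 0 (3 : Fin 4))) ⊓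
  ((∀' ∀' ∀' ∀' (pathFormula 0 1 2 3 ⟹ ∀' (edgeFormula 1 4 ⟹
    (equalFormula 4 0 ⊔ equalFormula 4 (2 : Fin 5))))) ⊓
  ((∀' ∀' ∀' ∀' (pathFormula 0 1 2 3 ⟹ ∀' (edgeFormula 2 4 ⟹
    (equalFormula 4 1 ⊔ equalFormula 4 (3 : Fin 5))))) ⊓
  ((∀' ∀' (labelFormula 0 0 ⟹ labelFormula 0 1 ⟹ ∼(edgeFormula 0 (1 : Fin 2)))) ⊓
  ((∀' ∀' ∀' ∀' ∀' ∀' (pathFormula 0 1 2 3 ⟹ pathFormula 0 4 5 3 ⟹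
    equalFormula 1 (4 : Fin 6))) ⊓
  ((∀' ∀' ∀' ∼(pathFormula 0 1 2 (0 : Fin 3))) ⊓
  ((∀' ∀' ∀' ∀' ∀' ∀' ∀' (pathFormula 0 1 2 3 ⟹ pathFormula 3 4 5 6 ⟹
    ∃' ∃' pathFormula 0 7 8 (6 : Fin 9))) ⊓
  (∀' ∀' (labelFormula 0 0 ⟹ labelFormula 0 1 ⟹ ∼(equalFormula 0 1) ⟹
    ∃' ∃' (pathFormula 0 2 3 1 ⊔ pathFormula 1 2 3 (0 : Fin 4))))))))))))

theorem models_gadLinFormula {V : Type} {G : LabelledGraph 3 V} {x : Fin 1 → V}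
    {xs : Fin 0 → V} : G.Models x gadLinFormula xs ↔ G.IsGadLin := by
  simp only [gadLinFormula, models_inf, models_sup, models_not, models_imp, models_all, models_ex,
    models_edgeFormula, models_labelFormula, models_equalFormula, models_pathFormula]
  exact ⟨fun ⟨h1, h2, h3, h4, h5, h6, h7, h8, h9, h10⟩ => ⟨h1, h2, h3, h4, h5, h6, h7, h8, h9, h10⟩,
    fun ⟨h1, h2, h3, h4, h5, h6, h7, h8, h9, h10⟩ => ⟨h1, h2, h3, h4, h5, h6, h7, h8, h9, h10⟩⟩

end LabelledGraph

open FirstOrder Language in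
theorem foExpressible_gadLin : FOExpressible gadLin := by
  let x : (graphLanguage 3).Term (Fin 1 ⊕ Fin 0) := Term.var (Sum.inl 0)
  -- The axioms form a sentence; the trivial conjunct `x = x` supplies the required free variable.
  refine ⟨⟨LabelledGraph.gadLinFormula ⊓ Term.bdEqual x x, ?_⟩, fun V _ G v => ?_⟩
  · refine Finset.Subset.antisymm (fun i _ => by simp [Subsingleton.elim i 0]) ?_
    have h : (Term.bdEqual x x).freeVarFinset = {0} := by
      simp [x, BoundedFormula.freeVarFinset, Term.bdEqual]
    change _ ⊆ (_ ∪ (BoundedFormula.freeVarFinset _ ∪ ∅)) ∪ ∅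
    rw [h]
    simp
  · rw [gadLin_iff]
    refine (LabelledGraph.models_inf (x := fun _ => v)).trans ?_
    rw [LabelledGraph.models_gadLinFormula]
    exact and_iff_left rfl

/-! ### Invariance of two-variable counting logic under capped colourings -/

namespace C2Formula

/-- The quantifier depth of a formula. -/
def depth {d : ℕ} : C2Formula d → ℕ
  | .equal _ _ => 0
  | .edge _ _ => 0
  | .label _ _ => 0
  | .neg φ => φ.depth
  | .and φ ψ => max φ.depth ψ.depth
  | .existsAtLeast _ _ φ => φ.depth + 1

/-- The largest number that is used in a counting quantifier of a formula. -/
def maxCount {d : ℕ} : C2Formula d → ℕ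
  | .equal _ _ => 0
  | .edge _ _ => 0
  | .label _ _ => 0
  | .neg φ => φ.maxCount
  | .and φ ψ => max φ.maxCount ψ.maxCount
  | .existsAtLeast k _ φ => max k φ.maxCount

end C2Formula

open Classical in
/-- The neighbours of a node in a colour class. -/
noncomputable def LabelledGraph.adjClass {d : ℕ} {V C : Type} [Fintype V] (G : LabelledGraph d V)
    (κ : V → C) (a : V) (c : C) : Finset V :=
  Finset.univ.filter fun w => G.Adj a w ∧ κ w = c

open Classical in
/-- The other nodes in a colour class that are not adjacent to a node. -/
noncomputable def LabelledGraph.nonAdjClass {d : ℕ} {V C : Type} [Fintype V]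
    (G : LabelledGraph d V) (κ : V → C) (a : V) (c : C) : Finset V :=
  Finset.univ.filter fun w => w ≠ a ∧ ¬ G.Adj a w ∧ κ w = c

/-- A sequence of increasingly finer colourings, common to two graphs, such that colours determine
the numbers of neighbours and non-neighbours in coarser classes, up to numbers larger than `k`. -/
structure CappedColouring {d : ℕ} {V C : Type} [Fintype V] (G H : LabelledGraph d V) (k q : ℕ)
    (κ : ℕ → V → C) : Prop where
  label : ∀ r x y, κ r x = κ r y → G.label x = H.label y
  mono : ∀ r x y, κ (r + 1) x = κ (r + 1) y → κ r x = κ r y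
  count : ∀ r < q, ∀ x y, κ (r + 1) x = κ (r + 1) y → ∀ c,
    (G.adjClass (κ r) x c).card = (H.adjClass (κ r) y c).card ∨
    (k ≤ (G.adjClass (κ r) x c).card ∧ k ≤ (H.adjClass (κ r) y c).card ∧
      k ≤ (G.nonAdjClass (κ r) x c).card ∧ k ≤ (H.nonAdjClass (κ r) y c).card)

theorem Finset.exists_card_eq_of_fiber_card_le {A B C : Type} [Fintype B] [DecidableEq C]
    (S : Finset A) (f : A → C) (g : B → C)
    (h : ∀ c, (S.filter fun a => f a = c).card ≤ (Finset.univ.filter fun b => g b = c).card) :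
    ∃ S' : Finset B, S'.card = S.card ∧ ∀ b ∈ S', ∃ a ∈ S, f a = g b := by
  classical
  choose T hT hcard using fun c => Finset.exists_subset_card_eq (h c)
  have hg : ∀ c, ∀ b ∈ T c, g b = c := fun c b hb => (Finset.mem_filter.1 (hT c hb)).2
  refine ⟨(S.image f).biUnion T, ?_, fun b hb => ?_⟩
  · rw [Finset.card_biUnion, Finset.card_eq_sum_card_image f S]
    · exact Finset.sum_congr rfl fun c _ => hcard c
    · intro c _ c' _ hne
      exact Finset.disjoint_left.2 fun b hb hb' => hne ((hg c b hb).symm.trans (hg c' b hb'))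
  · obtain ⟨c, hc, hb⟩ := Finset.mem_biUnion.1 hb
    obtain ⟨a, ha, rfl⟩ := Finset.mem_image.1 hc
    exact ⟨a, ha, (hg _ b hb).symm⟩

namespace CappedColouring

variable {d : ℕ} {V C : Type} [Fintype V] {G H : LabelledGraph d V} {k q : ℕ} {κ : ℕ → V → C}

theorem symm (h : CappedColouring G H k q κ) : CappedColouring H G k q κ where
  label r x y e := (h.label r y x e.symm).symm
  mono := h.mono
  count r hr x y e c := by
    rcases h.count r hr y x e.symm c with h | ⟨h1, h2, h3, h4⟩
    · exact .inl h.symm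
    · exact .inr ⟨h2, h1, h4, h3⟩

-- Both graphs of a `CappedColouring` share nodes and colours, hence class sizes. This identity thus
-- turns equal numbers of neighbours into equal numbers of non-neighbours.
open Classical in
theorem card_adjClass_add (G : LabelledGraph d V) (κ : V → C) (a : V) (c : C) :
    (G.adjClass κ a c).card + (G.nonAdjClass κ a c).card + (if κ a = c then 1 else 0) =
      (Finset.univ.filter fun w => κ w = c).card := by
  have h₁ : (if κ a = c then 1 else 0) = (Finset.univ.filter fun w => w = a ∧ κ w = c).card := by
    split_ifs with h
    · rw [eq_comm, Finset.card_eq_one]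
      exact ⟨a, by ext w; simp only [Finset.mem_filter, Finset.mem_univ, true_and,
        Finset.mem_singleton]; exact ⟨fun h => h.1, fun e => ⟨e, e ▸ h⟩⟩⟩
    · rw [eq_comm, Finset.card_eq_zero, Finset.filter_eq_empty_iff]
      rintro w - ⟨rfl, e⟩
      exact h e
  rw [h₁, LabelledGraph.adjClass, LabelledGraph.nonAdjClass, ← Finset.card_union_of_disjoint,
    ← Finset.card_union_of_disjoint]
  · congr 1
    ext w
    simp only [Finset.mem_union, Finset.mem_filter, Finset.mem_univ, true_and]
    tauto
  · rw [Finset.disjoint_left]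
    intro w
    simp only [Finset.mem_union, Finset.mem_filter, Finset.mem_univ, true_and]
    rintro (h | h) ⟨rfl, -⟩
    · exact G.loopless.irrefl _ h.1
    · exact h.1 rfl
  · rw [Finset.disjoint_left]
    intro w
    simp only [Finset.mem_filter, Finset.mem_univ, true_and]
    tauto

/-- One move of the counting game. Nodes are sorted by equality with, adjacency to, and colour
relative to the pebbled node. Each sort has equally many members on both sides, or at least `k ≥ m`
on the answering side, so a set of `m` witnesses can be answered sort by sort. -/
theorem transfer (h : CappedColouring G H k q κ) {r : ℕ} (hr : r < q) {a b : V}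
    (hab : κ (r + 1) a = κ (r + 1) b) {P Q : V → Prop}
    (hPQ : ∀ x y, κ r x = κ r y → (x = a ↔ y = b) → (G.Adj a x ↔ H.Adj b y) → P x → Q y)
    {m : ℕ} (hm : m ≤ k) (hP : ∃ S : Finset V, S.card = m ∧ ∀ w ∈ S, P w) :
    ∃ S : Finset V, S.card = m ∧ ∀ w ∈ S, Q w := by
  classical
  obtain ⟨S, hS, hP⟩ := hP
  obtain ⟨S', hS', hT⟩ := Finset.exists_card_eq_of_fiber_card_le S
    (fun w => (decide (w = a), decide (G.Adj a w), κ r w))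
    (fun w => (decide (w = b), decide (H.Adj b w), κ r w)) (by
      rintro ⟨e, e', c⟩
      have hab' := h.mono r _ _ hab
      have hle : ∀ (F : V → Prop) [DecidablePred F], (S.filter F).card ≤ k := fun F _ =>
        (Finset.card_le_card (Finset.filter_subset _ _)).trans (hS.le.trans hm)
      have hcount := h.count r hr a b hab c
      have hG := card_adjClass_add G (κ r) a c
      have hH := card_adjClass_add H (κ r) b c
      rw [hab'] at hG
      rcases e with _ | _
      · rcases e' with _ | _
        · have h₂ : (Finset.univ.filter fun w =>
              (decide (w = b), decide (H.Adj b w), κ r w) = (false, false, c)) =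
              H.nonAdjClass (κ r) b c := by
            ext w
            simp [LabelledGraph.nonAdjClass]
          rw [h₂]
          rcases hcount with hc | hc
          · have h₁ : (S.filter fun w =>
                (decide (w = a), decide (G.Adj a w), κ r w) = (false, false, c)) ⊆
                G.nonAdjClass (κ r) a c := by
              intro w
              simp [LabelledGraph.nonAdjClass]
            refine (Finset.card_le_card h₁).trans ?_
            omega
          · exact (hle _).trans hc.2.2.2
        · have h₂ : (Finset.univ.filter fun w =>
              (decide (w = b), decide (H.Adj b w), κ r w) = (false, true, c)) =
              H.adjClass (κ r) b c := by
            ext w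
            simp only [LabelledGraph.adjClass, Finset.mem_filter, Finset.mem_univ, true_and,
              Prod.mk.injEq, decide_eq_false_iff_not, decide_eq_true_eq, and_iff_right_iff_imp]
            rintro ⟨hw, -⟩ rfl
            exact H.loopless.irrefl _ hw
          rw [h₂]
          rcases hcount with hc | hc
          · have h₁ : (S.filter fun w =>
                (decide (w = a), decide (G.Adj a w), κ r w) = (false, true, c)) ⊆
                G.adjClass (κ r) a c := by
              intro w
              simp +contextual [LabelledGraph.adjClass]
            exact (Finset.card_le_card h₁).trans hc.le
          · exact (hle _).trans hc.2.1
      · rcases Finset.eq_empty_or_nonempty (S.filter fun w =>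
          (decide (w = a), decide (G.Adj a w), κ r w) = (true, e', c)) with h₀ | ⟨w, hw⟩
        · exact (Finset.card_eq_zero.2 h₀).le.trans (Nat.zero_le _)
        · refine (Finset.card_le_one.2 fun x hx y hy => ?_).trans
            (Finset.card_pos.2 ⟨b, ?_⟩)
          · simp only [Finset.mem_filter, Prod.mk.injEq, decide_eq_true_eq] at hx hy
            exact hx.2.1.trans hy.2.1.symm
          · simp only [Finset.mem_filter, Prod.mk.injEq, decide_eq_true_eq] at hw
            obtain ⟨-, rfl, rfl, rfl⟩ := hw
            simp [hab'])
  refine ⟨S', hS'.trans hS, fun y hy => ?_⟩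
  obtain ⟨x, hx, e⟩ := hT y hy
  simp only [Prod.mk.injEq, decide_eq_decide] at e
  exact hPQ x y e.2.2 e.1 e.2.1 (hP x hx)

theorem sat_iff (h : CappedColouring G H k q κ) (φ : C2Formula d) :
    ∀ r, φ.depth ≤ r → r ≤ q → φ.maxCount ≤ k → ∀ s t : Fin 2 → V,
      (∀ i, κ r (s i) = κ r (t i)) → (∀ i j, s i = s j ↔ t i = t j) →
      (∀ i j, G.Adj (s i) (s j) ↔ H.Adj (t i) (t j)) → (φ.Sat G s ↔ φ.Sat H t) := by
  induction φ with
  | equal i j => exact fun _ _ _ _ s t _ he _ => he i j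
  | edge i j => exact fun _ _ _ _ s t _ _ ha => ha i j
  | label p i =>
    intro r _ _ _ s t hκ _ _
    simp only [C2Formula.Sat, h.label r _ _ (hκ i)]
  | neg φ ih =>
    intro r hd hr hm s t hκ he ha
    exact not_congr (ih r hd hr hm s t hκ he ha)
  | and φ ψ ih₁ ih₂ =>
    intro r hd hr hm s t hκ he ha
    exact and_congr
      (ih₁ r ((le_max_left _ _).trans hd) hr ((le_max_left _ _).trans hm) s t hκ he ha)
      (ih₂ r ((le_max_right _ _).trans hd) hr ((le_max_right _ _).trans hm) s t hκ he ha)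
  | existsAtLeast m i φ ih =>
    intro r hd hr hm s t hκ he ha
    obtain _ | r := r
    · simp [C2Formula.depth] at hd
    have hd : φ.depth ≤ r := Nat.le_of_succ_le_succ hd
    obtain ⟨j, hj, hij⟩ : ∃ j : Fin 2, j ≠ i ∧ ∀ l, l = i ∨ l = j := by
      fin_cases i
      · exact ⟨1, by decide, by decide⟩
      · exact ⟨0, by decide, by decide⟩
    -- Requantifying variable `i` forgets its old value, so only the relation of the new node to the
    -- value of the other variable `j` matters.
    have key : ∀ x y, κ r x = κ r y → (x = s j ↔ y = t j) → (G.Adj (s j) x ↔ H.Adj (t j) y) →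
        (φ.Sat G (Function.update s i x) ↔ φ.Sat H (Function.update t i y)) := by
      intro x y hxy he' ha'
      refine ih r hd (Nat.le_of_succ_le hr) ((le_max_right _ _).trans hm) _ _ ?_ ?_ ?_
      · intro l
        rcases hij l with rfl | rfl
        · simpa using hxy
        · simpa [hj] using h.mono r _ _ (hκ l)
      · intro l l'
        rcases hij l with rfl | rfl <;> rcases hij l' with rfl | rfl <;> simp [hj, he']
        simp [eq_comm (a := s _), eq_comm (a := t _), he']
      · intro l l'
        rcases hij l with rfl | rfl <;> rcases hij l' with rfl | rfl <;> simp [hj, ha']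
        rw [G.adj_comm, ha', H.adj_comm]
    exact ⟨h.transfer hr (hκ j) (fun x y e₁ e₂ e₃ => (key x y e₁ e₂ e₃).1)
        ((le_max_left _ _).trans hm),
      h.symm.transfer hr (hκ j).symm
        (fun x y e₁ e₂ e₃ => (key y x e₁.symm e₂.symm e₃.symm).2) ((le_max_left _ _).trans hm)⟩

end CappedColouring

/-! ### Redirected gadgets and their colouring -/

/-- The strict linear order on `Fin N` as a directed graph. -/
def finOrder (N : ℕ) : LabelledDigraph 0 (Fin N) where
  edge u w := u < w
  irrefl := lt_irrefl
  label _ i := i.elim0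

instance finite_gadNode (N : ℕ) : Finite (GadNode (finOrder N)) := by
  refine Finite.of_injective (β := Fin 3 × Fin N × Fin N) (fun x => match x with
    | .one u => (0, u, u)
    | .two u w _ => (1, u, w)
    | .three u w _ => (2, u, w)) ?_
  rintro (_ | _ | _) (_ | _ | _) h <;> simp_all

/-- Adjacency in the gadgetisation, listed in one direction, where `τ u w` replaces the end `w` of
the gadget of the edge `(u, w)`. -/
def redirectRel {N : ℕ} (τ : Fin N → Fin N → Fin N) :
    GadNode (finOrder N) → GadNode (finOrder N) → Prop
  | .one u, .two u' _ _ => u' = u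
  | .two u w _, .three u' w' _ => u' = u ∧ w' = w
  | .three u w _, .one x => x = τ u w
  | _, _ => False

/-- The gadgetisation of the linear order on `Fin N` with redirected gadgets. -/
def redirect {N : ℕ} (τ : Fin N → Fin N → Fin N) : LabelledGraph 3 (GadNode (finOrder N)) where
  Adj x y := redirectRel τ x y ∨ redirectRel τ y x
  symm := ⟨fun _ _ h => h.symm⟩
  loopless := ⟨fun x h => by rcases x with _ | _ | _ <;> simp [redirectRel] at h⟩
  label := (gad (finOrder N)).label

section

variable {N : ℕ} {τ : Fin N → Fin N → Fin N}

theorem redirect_adj_one {i : Fin N} {y : GadNode (finOrder N)} :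
    (redirect τ).Adj (.one i) y ↔
      (∃ l h, y = .two i l h) ∨ ∃ u l h, y = .three u l h ∧ τ u l = i := by
  rcases y with _ | ⟨u, w, h⟩ | ⟨u, w, h⟩
  · simp [redirect, redirectRel]
  · simp only [redirect, redirectRel, or_false, GadNode.two.injEq, reduceCtorEq, false_and,
      exists_false]
    exact ⟨fun e => ⟨w, e ▸ h, e, rfl⟩, fun ⟨_, _, e, _⟩ => e⟩
  · simp only [redirect, redirectRel, false_or, GadNode.three.injEq, reduceCtorEq, exists_false]
    exact ⟨fun e => ⟨u, w, h, ⟨rfl, rfl⟩, e.symm⟩, fun ⟨_, _, _, ⟨e, e'⟩, h⟩ => by rw [e, e', h]⟩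

theorem redirect_adj_two {u w : Fin N} {h} {y : GadNode (finOrder N)} :
    (redirect τ).Adj (.two u w h) y ↔ y = .one u ∨ y = .three u w h := by
  rcases y with _ | ⟨u', w', h'⟩ | ⟨u', w', h'⟩ <;> simp [redirect, redirectRel, eq_comm]

theorem redirect_adj_three {u w : Fin N} {h} {y : GadNode (finOrder N)} :
    (redirect τ).Adj (.three u w h) y ↔ y = .two u w h ∨ y = .one (τ u w) := by
  rcases y with _ | ⟨u', w', h'⟩ | ⟨u', w', h'⟩ <;> simp [redirect, redirectRel, eq_comm]

theorem isGadLin_redirect_snd : (redirect fun _ w : Fin N => w).IsGadLin := by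
  refine .of_isIso (H := gad (finOrder N)) ⟨⟨Equiv.refl _, ?_⟩, fun _ => rfl⟩
    (isGadLin_gad (finOrder N) ?_)
  · have : ∀ x y, GadEdge (finOrder N) x y ↔ redirectRel (fun _ w : Fin N => w) x y := by
      intro x y
      constructor
      · rintro (_ | _ | _) <;> simp [redirectRel]
      · rcases x with u | ⟨u, w, h⟩ | ⟨u, w, h⟩ <;> rcases y with u' | ⟨u', w', h'⟩ | ⟨u', w', h'⟩ <;>
          simp only [redirectRel, false_imp_iff]
        · rintro rfl
          exact .first _ _ _
        · rintro ⟨rfl, rfl⟩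
          exact .second _ _ _
        · rintro rfl
          exact .third _ _ _
    intro x y
    exact or_congr (this x y) (this y x)
  · exact inferInstanceAs (IsStrictTotalOrder (Fin N) (· < ·))

/-- The colour of a position: `none` for the positions at distance at least `T` from both ends. -/
def positionColour (T : ℕ) (i : Fin N) : Option (Fin N) :=
  if T ≤ i ∧ i + T < N then none else some i

/-- The colour of a node of the gadgetisation. -/
def gadColour (T : ℕ) : GadNode (finOrder N) → Fin 3 × Option (Fin N) × Option (Fin N)
  | .one u => (0, positionColour T u, none)
  | .two u w _ => (1, positionColour T u, positionColour T w)
  | .three u w _ => (2, positionColour T u, positionColour T w)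

theorem positionColour_eq_none {T : ℕ} {i : Fin N} :
    positionColour T i = none ↔ T ≤ i ∧ i + T < N := by
  simp [positionColour]

theorem positionColour_eq_iff {T : ℕ} {i j : Fin N} :
    positionColour T i = positionColour T j ↔
      i = j ∨ ((T ≤ i ∧ i + T < N) ∧ (T ≤ j ∧ j + T < N)) := by
  unfold positionColour
  split_ifs with h h' h' <;> simp [h, h']
  rintro rfl
  exact h' h
  rintro rfl
  exact h h'

theorem positionColour_mono {S T : ℕ} (h : S ≤ T) {i j : Fin N}
    (e : positionColour T i = positionColour T j) : positionColour S i = positionColour S j := by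
  rw [positionColour_eq_iff] at *
  omega

/-- Gadgets are redirected only between positions at distance at least `T` from both ends. -/
def CentralRedirection (T : ℕ) (τ : Fin N → Fin N → Fin N) : Prop :=
  ∀ u w, τ u w = w ∨ (T ≤ u ∧ positionColour T w = none ∧ positionColour T (τ u w) = none)

theorem gadColour_mono {S T : ℕ} (h : S ≤ T) {x y : GadNode (finOrder N)}
    (e : gadColour T x = gadColour T y) : gadColour S x = gadColour S y := by
  rcases x with _ | _ | _ <;> rcases y with _ | _ | _ <;> simp [gadColour] at e ⊢
  · exact positionColour_mono h e
  · exact ⟨positionColour_mono h e.1, positionColour_mono h e.2⟩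
  · exact ⟨positionColour_mono h e.1, positionColour_mono h e.2⟩

theorem CentralRedirection.positionColour_eq {S T : ℕ} (hτ : CentralRedirection T τ) (h : S ≤ T)
    (u w : Fin N) : positionColour S (τ u w) = positionColour S w := by
  rcases hτ u w with e | ⟨-, e, e'⟩
  · rw [e]
  · exact positionColour_mono h (e'.trans e.symm)

/-- Gadgets starting near the lower end are untouched; they later serve as reliable witnesses. -/
theorem CentralRedirection.eq_of_lt {T : ℕ} (hτ : CentralRedirection T τ) {u w : Fin N}
    (h : u < T) : τ u w = w :=
  (hτ u w).resolve_right fun e => absurd e.1 (by omega)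

theorem CentralRedirection.eq_iff {T : ℕ} (hτ : CentralRedirection T τ) {u w i : Fin N}
    (hi : positionColour T i ≠ none) : τ u w = i ↔ w = i := by
  rcases hτ u w with e | ⟨-, e, e'⟩
  · rw [e]
  · constructor <;> rintro rfl <;> contradiction

theorem Finset.card_le_card_of_subsingleton {α : Type} {s t : Finset α}
    (h : ∀ x ∈ s, ∀ y ∈ s, x = y) (h' : ∀ x ∈ s, ∃ y, y ∈ t) : s.card ≤ t.card := by
  rcases s.eq_empty_or_nonempty with rfl | ⟨x, hx⟩
  · simp
  · exact (Finset.card_le_one.2 h).trans (Finset.card_pos.2 (h' x hx))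

theorem Finset.le_card_of_injective {α : Type} {s : Finset α} {k : ℕ} (g : Fin k → α)
    (hg : Function.Injective g) (h : ∀ t, g t ∈ s) : k ≤ s.card := by
  simpa using Finset.card_le_card_of_injOn (s := Finset.univ) g (fun t _ => h t) hg.injOn

end

section

variable {N : ℕ} [Fintype (GadNode (finOrder N))] {τ τ' : Fin N → Fin N → Fin N} {k S T : ℕ}

/-- The hypotheses are symmetric enough that two applications give equality. Gadget nodes have at
most one neighbour per colour, and so do central positions for the colours allowed by `hc`, since
such a colour names a position near an end. Non-central positions have the same neighbours in both
graphs. -/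
theorem card_adjClass_redirect_le (hτ : CentralRedirection T τ) (hτ' : CentralRedirection T τ')
    (hST : S + k + 2 ≤ T) {R : ℕ} (hSR : S ≤ R) (hRT : R ≤ T) {x y : GadNode (finOrder N)}
    (hxy : gadColour R x = gadColour R y) {c : Fin 3 × Option (Fin N) × Option (Fin N)}
    (hc : ∀ i, x = .one i → positionColour R i = none →
      c ≠ (1, none, none) ∧ c ≠ (2, none, none)) :
    ((redirect τ).adjClass (gadColour S) x c).card ≤
      ((redirect τ').adjClass (gadColour S) y c).card := by
  have hxy' := gadColour_mono hSR hxy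
  simp only [LabelledGraph.adjClass]
  rcases x with i | ⟨u, w, h⟩ | ⟨u, w, h⟩
  · rcases y with i' | _ | _ <;> simp [gadColour] at hxy
    by_cases hi : positionColour R i = none
    · have hi' := hxy ▸ hi
      have hi₀ := positionColour_eq_none.1 hi
      have hi₀' := positionColour_eq_none.1 hi'
      obtain ⟨hc₁, hc₂⟩ := hc i rfl hi
      have hiS : positionColour S i = none := positionColour_eq_none.2 (by omega)
      have hiS' : positionColour S i' = none := positionColour_eq_none.2 (by omega)
      have key₂ : ∀ l h, gadColour S (.two i l h) = c → ¬ (S ≤ l ∧ l + S < N) := by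
        rintro l h rfl hl
        exact hc₁ (by simp [gadColour, hiS, positionColour_eq_none.2 hl])
      -- Redirection keeps `l` central, so `u` must be non-central; being below `l`, it lies near
      -- the lower end, where no gadget is redirected.
      have key₃ : ∀ u l h, gadColour S (.three u l h) = c → τ u l = i → ↑u < S ∧ l = i := by
        rintro u l h rfl rfl
        have hlS := hτ.positionColour_eq (hSR.trans hRT) u l
        rw [hiS] at hlS
        have hl := positionColour_eq_none.1 hlS.symm
        have hu : ¬ (S ≤ u ∧ u + S < N) := fun hu =>
          hc₂ (by simp [gadColour, ← hlS, positionColour_eq_none.2 hu])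
        have h : u < l := h
        have hu : u < S := by omega
        exact ⟨hu, (hτ.eq_of_lt (by omega)).symm⟩
      refine Finset.card_le_card_of_subsingleton ?_ ?_
      · simp only [Finset.mem_filter, Finset.mem_univ, true_and, redirect_adj_one]
        rintro x ⟨⟨l, h, rfl⟩ | ⟨u, l, h, rfl, e⟩, hx⟩ y ⟨⟨l', h', rfl⟩ | ⟨u', l', h', rfl, e'⟩, hy⟩
        · have hl := key₂ l h hx
          have := congrArg (·.2.2) (hx.trans hy.symm)
          simp only [gadColour, positionColour_eq_iff, hl, false_and, or_false] at this
          subst this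
          rfl
        · have := congrArg (·.1) (hx.trans hy.symm)
          simp [gadColour] at this
        · have := congrArg (·.1) (hx.trans hy.symm)
          simp [gadColour] at this
        · obtain ⟨hu, rfl⟩ := key₃ u l h hx e
          obtain ⟨hu', rfl⟩ := key₃ u' l' h' hy e'
          have := congrArg (·.2.1) (hx.trans hy.symm)
          simp only [gadColour, positionColour_eq_iff] at this
          obtain rfl : u = u' := by omega
          rfl
      · simp only [Finset.mem_filter, Finset.mem_univ, true_and, redirect_adj_one]
        rintro x ⟨⟨l, h, rfl⟩ | ⟨u, l, h, rfl, e⟩, hx⟩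
        · have hl := key₂ l h hx
          have h : i < l := h
          have h' : i' < l := by omega
          refine ⟨.two i' l h', .inl ⟨_, _, rfl⟩, ?_⟩
          rw [← hx]
          simp [gadColour, hiS, hiS']
        · obtain ⟨hu, rfl⟩ := key₃ u l h hx e
          have h' : u < i' := by omega
          refine ⟨.three u i' h', .inr ⟨_, _, _, rfl, hτ'.eq_of_lt (by omega)⟩, ?_⟩
          rw [← hx]
          simp [gadColour, hiS, hiS']
    · obtain rfl : i = i' := by
        rw [positionColour_eq_none] at hi
        rw [positionColour_eq_iff] at hxy
        exact hxy.resolve_right fun h => hi h.1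
      have hiT : positionColour T i ≠ none := fun e => hi <| by
        rw [positionColour_eq_none] at *
        omega
      refine Finset.card_le_card fun z => ?_
      simp only [Finset.mem_filter, Finset.mem_univ, true_and, redirect_adj_one, hτ.eq_iff hiT,
        hτ'.eq_iff hiT, imp_self]
  · rcases y with _ | ⟨u', w', h'⟩ | _ <;> simp [gadColour] at hxy hxy'
    refine Finset.card_le_card_of_subsingleton ?_ ?_
    · simp only [Finset.mem_filter, Finset.mem_univ, true_and, redirect_adj_two]
      rintro x ⟨rfl | rfl, rfl⟩ y ⟨rfl | rfl, hy⟩ <;> simp [gadColour] at hy ⊢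
    · simp only [Finset.mem_filter, Finset.mem_univ, true_and, redirect_adj_two]
      rintro x ⟨rfl | rfl, rfl⟩
      · exact ⟨_, .inl rfl, by simp [gadColour, hxy']⟩
      · exact ⟨_, .inr rfl, by simp [gadColour, hxy']⟩
  · rcases y with _ | _ | ⟨u', w', h'⟩ <;> simp [gadColour] at hxy hxy'
    refine Finset.card_le_card_of_subsingleton ?_ ?_
    · simp only [Finset.mem_filter, Finset.mem_univ, true_and, redirect_adj_three]
      rintro x ⟨rfl | rfl, rfl⟩ y ⟨rfl | rfl, hy⟩ <;> simp [gadColour] at hy ⊢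
    · simp only [Finset.mem_filter, Finset.mem_univ, true_and, redirect_adj_three]
      rintro x ⟨rfl | rfl, rfl⟩
      · exact ⟨_, .inl rfl, by simp [gadColour, hxy']⟩
      · exact ⟨_, .inr rfl, by simp [gadColour, hxy', hτ.positionColour_eq (hSR.trans hRT),
          hτ'.positionColour_eq (hSR.trans hRT)]⟩

/-- The additional margin `k + 2` leaves room for `k` central positions `S + t` below, a central
non-neighbour `S + k + 1` still below `i`, and `k` central positions above `i`. Gadgets from `S + t`
to `S + k + 1` avoid `i`, while those from `i` upwards or from `S + t` to `i` are adjacent to it at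
the relevant end. -/
theorem le_card_adjClass_redirect (hτ : CentralRedirection T τ) (hST : S + k + 2 ≤ T)
    {i : Fin N} (hi : positionColour (S + k + 2) i = none)
    {c : Fin 3 × Option (Fin N) × Option (Fin N)} (hc : c = (1, none, none) ∨ c = (2, none, none)) :
    k ≤ ((redirect τ).adjClass (gadColour S) (.one i) c).card ∧
      k ≤ ((redirect τ).nonAdjClass (gadColour S) (.one i) c).card := by
  rw [positionColour_eq_none] at hi
  have hiS : positionColour S i = none := positionColour_eq_none.2 (by omega)
  have hlow : ∀ t : Fin k, S + t < N := by omega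
  have hlowS : ∀ t : Fin k, positionColour S (⟨S + t, hlow t⟩ : Fin N) = none := fun t =>
    positionColour_eq_none.2 ⟨by simp, by simp only; omega⟩
  have hend : S + k + 1 < N := by omega
  have hendS : positionColour S (⟨S + k + 1, hend⟩ : Fin N) = none :=
    positionColour_eq_none.2 ⟨by simp only; omega, by simp only; omega⟩
  have hlt : ∀ t : Fin k, (finOrder N).edge ⟨S + t, hlow t⟩ ⟨S + k + 1, hend⟩ := fun t =>
    Fin.mk_lt_mk.2 (by omega)
  have hlti : ∀ t : Fin k, (finOrder N).edge ⟨S + t, hlow t⟩ i := fun t =>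
    Fin.lt_def.2 (by simp only; omega)
  have hgt : ∀ t : Fin k, (i : ℕ) + 1 + t < N := by omega
  have hgti : ∀ t : Fin k, (finOrder N).edge i ⟨i + 1 + t, hgt t⟩ := fun t =>
    Fin.lt_def.2 (by simp only; omega)
  have hgtS : ∀ t : Fin k, positionColour S (⟨i + 1 + t, hgt t⟩ : Fin N) = none := fun t =>
    positionColour_eq_none.2 ⟨by simp only; omega, by simp only; omega⟩
  rcases hc with rfl | rfl
  · refine ⟨Finset.le_card_of_injective (fun t => .two i _ (hgti t)) ?_ ?_,
      Finset.le_card_of_injective (fun t => .two _ _ (hlt t)) ?_ ?_⟩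
    · intro t t' e
      simpa [Fin.val_inj] using e
    · intro t
      simp only [LabelledGraph.adjClass, Finset.mem_filter, Finset.mem_univ, true_and,
        redirect_adj_one]
      exact ⟨.inl ⟨_, _, rfl⟩, by simp [gadColour, hiS, hgtS]⟩
    · intro t t' e
      simpa [Fin.val_inj] using e
    · intro t
      simp only [LabelledGraph.nonAdjClass, Finset.mem_filter, Finset.mem_univ, true_and,
        redirect_adj_one]
      refine ⟨by simp, ?_, by simp [gadColour, hlowS, hendS]⟩
      rintro (⟨l, h, e⟩ | ⟨u, l, h, e, -⟩)
      · simp only [GadNode.two.injEq, Fin.ext_iff] at e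
        omega
      · simp at e
  · refine ⟨Finset.le_card_of_injective (fun t => .three _ i (hlti t)) ?_ ?_,
      Finset.le_card_of_injective (fun t => .three _ _ (hlt t)) ?_ ?_⟩
    · intro t t' e
      simpa [Fin.val_inj] using e
    · intro t
      simp only [LabelledGraph.adjClass, Finset.mem_filter, Finset.mem_univ, true_and,
        redirect_adj_one]
      exact ⟨.inr ⟨_, _, _, rfl, hτ.eq_of_lt (by simp only; omega)⟩,
        by simp [gadColour, hiS, hlowS]⟩
    · intro t t' e
      simpa [Fin.val_inj] using e
    · intro t
      simp only [LabelledGraph.nonAdjClass, Finset.mem_filter, Finset.mem_univ, true_and,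
        redirect_adj_one]
      refine ⟨by simp, ?_, by simp [gadColour, hlowS, hendS]⟩
      rintro (⟨l, h, e⟩ | ⟨u, l, h, e, e'⟩)
      · simp at e
      · simp only [GadNode.three.injEq] at e
        obtain ⟨rfl, rfl⟩ := e
        rw [hτ.eq_of_lt (by simp only; omega), Fin.ext_iff] at e'
        simp only at e'
        omega

theorem cappedColouring_redirect (k q : ℕ) (hτ : CentralRedirection ((k + 2) * q) τ)
    (hτ' : CentralRedirection ((k + 2) * q) τ') :
    CappedColouring (redirect τ) (redirect τ') k q fun r => gadColour (N := N) ((k + 2) * r) where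
  label r x y e := by
    rcases x with _ | _ | _ <;> rcases y with _ | _ | _ <;> simp [gadColour] at e <;> rfl
  mono r x y e := gadColour_mono (Nat.mul_le_mul_left _ (Nat.le_succ r)) e
  count r hr x y e c := by
    have hST : (k + 2) * r + k + 2 ≤ (k + 2) * q := by
      rw [add_assoc, ← Nat.mul_succ]
      exact Nat.mul_le_mul_left _ hr
    rw [Nat.mul_succ, ← add_assoc] at e
    -- The cap is needed only for a central position and a class of wholly central gadgets; all
    -- other counts agree exactly.
    by_cases hc : (∃ i, x = .one i ∧ positionColour ((k + 2) * r + k + 2) i = none) ∧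
      (c = (1, none, none) ∨ c = (2, none, none))
    · obtain ⟨⟨i, rfl, hi⟩, hc⟩ := hc
      rcases y with i' | _ | _ <;> simp [gadColour] at e
      have h₁ := le_card_adjClass_redirect hτ hST hi hc
      have h₂ := le_card_adjClass_redirect hτ' hST (e ▸ hi) hc
      exact .inr ⟨h₁.1, h₂.1, h₁.2, h₂.2⟩
    · refine .inl (le_antisymm
        (card_adjClass_redirect_le hτ hτ' hST (by omega) hST e ?_)
        (card_adjClass_redirect_le hτ' hτ hST (by omega) hST e.symm ?_))
      · rintro i rfl hi
        simpa [hi] using hc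
      · rintro i rfl hi
        rcases x with i' | _ | _ <;> simp [gadColour] at e
        simpa [e, hi] using hc

end

/-! ### Inexpressibility and conclusion -/

theorem not_c2Expressible_gadLin : ¬ C2Expressible gadLin := by
  rintro ⟨φ, -, hφ⟩
  let T := (φ.maxCount + 2) * φ.depth
  -- Among `2 * T + 2` positions exactly `T` and `T + 1` are at distance at least `T` from both
  -- ends.
  let a : Fin (2 * T + 2) := ⟨T, by omega⟩
  let b : Fin (2 * T + 2) := ⟨T + 1, by omega⟩
  let τ : Fin (2 * T + 2) → Fin (2 * T + 2) → Fin (2 * T + 2) := fun u w =>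
    if u = a ∧ w = b then a else w
  have hab : (finOrder _).edge a b := Fin.mk_lt_mk.2 (Nat.lt_succ_self T)
  have hτab : τ a b = a := if_pos ⟨rfl, rfl⟩
  have ha : positionColour T a = none := positionColour_eq_none.2 ⟨le_rfl, by simp only [a]; omega⟩
  have hb : positionColour T b = none :=
    positionColour_eq_none.2 ⟨by simp only [b]; omega, by simp only [b]; omega⟩
  have hτ : CentralRedirection T τ := by
    intro u w
    by_cases h : u = a ∧ w = b
    · rw [h.1, h.2, hτab]
      exact .inr ⟨le_rfl, hb, ha⟩
    · exact .inl (if_neg h)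
  have hsnd : CentralRedirection T fun _ w : Fin (2 * T + 2) => w := fun _ _ => .inl rfl
  let _ := Fintype.ofFinite (GadNode (finOrder (2 * T + 2)))
  have hsat := (cappedColouring_redirect φ.maxCount φ.depth hsnd hτ).sat_iff φ φ.depth le_rfl le_rfl
    le_rfl (fun _ => .one a) (fun _ => .one a) (fun _ => rfl) (fun _ _ => Iff.rfl)
    (fun _ _ => by simp)
  have h₁ := (hφ _ (redirect fun _ w => w) (.one a)).trans (gadLin_iff _ _ _)
  have h₂ := (hφ _ (redirect τ) (.one a)).trans (gadLin_iff _ _ _)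
  have h := (h₁.symm.trans (hsat.trans h₂)).1 isGadLin_redirect_snd
  -- The redirected gadget of `(a, b)` is a loop at `a`.
  refine h.irrefl (.one a) (.two a b hab) (.three a b hab) ⟨rfl, rfl, rfl, rfl, ?_, ?_, ?_⟩
  · exact redirect_adj_one.2 (.inl ⟨_, _, rfl⟩)
  · exact redirect_adj_two.2 (.inr rfl)
  · exact redirect_adj_three.2 (.inr (by rw [hτab]))

theorem mainTheorem9 :
    (∃ φ : FOFormula 3, ACRExpressible φ.classifier ∧ ¬ C2Expressible φ.classifier) ∧
    (FOExpressible gadLin ∧ ACRExpressible gadLin ∧ ¬ C2Expressible gadLin) ∧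
    ¬ (∀ (d : ℕ) (A : NodeClassifier d),
        (FOExpressible A ∧ ACRExpressible A) ↔ C2Expressible A) := by
  refine ⟨?_, ⟨foExpressible_gadLin, acrExpressible_gadLin, not_c2Expressible_gadLin⟩, fun h =>
    not_c2Expressible_gadLin ((h 3 gadLin).1 ⟨foExpressible_gadLin, acrExpressible_gadLin⟩)⟩
  obtain ⟨φ, hφ⟩ := foExpressible_gadLin
  obtain ⟨N, hN⟩ := acrExpressible_gadLin
  exact ⟨φ, ⟨N, fun V _ G v => (hN V G v).trans (hφ V G v).symm⟩, fun ⟨ψ, hψ, h⟩ =>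
    not_c2Expressible_gadLin ⟨ψ, hψ, fun V _ G v => (h V G v).trans (hφ V G v)⟩⟩
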